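/- Let $\mathfrak A$ be a unital $C^*$-algebra with a $\mathbb Z_2$-grading, that is, a $*$-automorphism $\theta$ with $\theta^2=\mathrm{id}$; elements with $\theta(a)=a$ are called even and those with $\theta(a)=-a$ odd. A state $\rho$ on $\mathfrak A$ is even if $\rho\circ\theta=\rho$. Let $\hat\otimes^{\mathbb N}\mathfrak A$ be the algebraic infinite Fermi tensor product: the span of the elementary tensors $a_1\hat\otimes\cdots\hat\otimes a_n\hat\otimes 1\hat\otimes 1\hat\otimes\cdots$ in the infinite tensor product of vector spaces, with the product and involution given on homogeneous $a_i$, $b_i$ of degrees $s_i,t_i\in\{0,1\}$ (0 for even, 1 for odd) by $$(\hat\otimes_i a_i)(\hat\otimes_i b_i)=(-1)^{\sum_{j<i}s_it_j}\,\hat\otimes_i a_ib_i,\qquad (\hat\otimes_i a_i)^*=(-1)^{\sum_{j<i}s_is_j}\,\hat\otimes_i a_i^*.$$ Let $\iota_j(a)=1\hat\otimes\cdots\hat\otimes 1\hat\otimes a\hat\otimes 1\hat\otimes\cdots$ be the embedding of $\mathfrak A$ as the $j$-th factor. For even states $\rho_i$ of $\mathfrak A$, the product state $\times_i\rho_i$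 is the state determined by $(\times_i\rho_i)(a_1\hat\otimes\cdots\hat\otimes a_n\hat\otimes 1\hat\otimes\cdots)=\rho_1(a_1)\cdots\rho_n(a_n)$. The minimal infinite Fermi tensor product $\hat\otimes^{\mathbb N}_{\min}\mathfrak A$ is the completion in the norm $\|x\|_{\min}=\sup\|\pi_\omega(x)\|$, where $\omega$ runs over all product states $\times_i\rho_i$ of sequences of even states and $\pi_\omega$ is the GNS representation of $\omega$. Write $\times^{\mathbb N}\rho$ for the extension to $\hat\otimes^{\mathbb N}_{\min}\mathfrak A$ of the product state with $\rho_i=\rho$ for all $i$. The group $\mathbb P_{\mathbb N}$ of finite permutations of $\mathbb N=\{1,2,\dots\}$ acts on $\hat\otimes^{\mathbb N}_{\min}\mathfrak A$ by the $*$-automorphisms $\alpha_\sigma$ determined by $\alpha_\sigma(\iota_j(a))=\iota_{\sigma(j)}(a)$ for $j\in\mathbb N$ and $a\in\mathfrak A$. A state $\omega$ on $\hat\otimes^{\mathbb N}_{\min}\mathfrak A$ is symmetric if $\omega\circ\alpha_\sigma=\omega$ for every $\sigma\in\mathbb P_{\mathbb N}$. For a symmetric state $\omega$ on $\hat\otimes^{\mathbb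 N}_{\min}\mathfrak A$ the following conditions are equivalent: 1. $\omega$ is extreme, that is, an extreme point of the convex set of symmetric states; 2. $\omega$ is strongly clustering, that is, $\lim_{n\to\infty}\omega(\alpha_{\sigma_n}(a)b)=\omega(a)\omega(b)$ for all $a,b\in\hat\otimes^{\mathbb N}_{\min}\mathfrak A$, where $\sigma_n(k)=k+2^{n-1}$ for $1\le k\le 2^{n-1}$, $\sigma_n(k)=k-2^{n-1}$ for $2^{n-1}<k\le 2^n$, and $\sigma_n(k)=k$ for $k>2^n$; 3. there is an even state $\rho$ on $\mathfrak A$ such that $\omega=\times^{\mathbb N}\rho$. -/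

import Mathlib

open scoped TensorProduct DirectSum ComplexOrder

noncomputable section

namespace Fermi

/-- A `ℤ/2`-grading of a unital C*-algebra: an involutive unital `*`-automorphism. -/
structure Grading (A : Type*) [CStarAlgebra A] where
  /-- The grading automorphism. -/
  θ : A ≃⋆ₐ[ℂ] A
  invol : ∀ a, θ (θ a) = a

/-- The sign `(-1) ^ e` for `e ∈ ℤ/2`. -/
def sgn (e : ZMod 2) : ℂ := if e = 0 then 1 else -1

lemma deg_cases (e : ZMod 2) : e = 0 ∨ e = 1 := by
  revert e; decide

lemma sgn_zero : sgn 0 = 1 := by simp [sgn]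

lemma sgn_one : sgn 1 = -1 := by simp [sgn]

lemma sgn_add (d e : ZMod 2) : sgn (d + e) = sgn d * sgn e := by
  have h : (1 : ZMod 2) + 1 = 0 := by decide
  rcases deg_cases d with rfl | rfl <;> rcases deg_cases e with rfl | rfl <;> simp [sgn, h]

lemma sgn_mul_self (e : ZMod 2) : sgn e * sgn e = 1 := by
  rcases deg_cases e with rfl | rfl <;> simp [sgn]

lemma conj_sgn (e : ZMod 2) : (starRingEnd ℂ) (sgn e) = sgn e := by
  rcases deg_cases e with rfl | rfl <;> simp [sgn]

/-- A finitely supported family of degrees, one for each tensor factor. -/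
abbrev Deg : Type := ℕ →₀ ZMod 2

/-- The exponent `∑_{j < i} s i * t j` of the sign that arises when homogeneous elementary tensors
of degrees `s` and `t` are multiplied. -/
def crossing (s t : Deg) : ZMod 2 :=
  s.sum fun i a => t.sum fun j b => if j < i then a * b else 0

lemma crossing_eq (s t : Deg) (S : Finset ℕ) (hs : s.support ⊆ S) (ht : t.support ⊆ S) :
    crossing s t = ∑ i ∈ S, ∑ j ∈ S, if j < i then s i * t j else 0 := by
  unfold crossing
  rw [Finsupp.sum_of_support_subset s hs _ (by simp)]
  refine Finset.sum_congr rfl fun i _ => ?_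
  rw [Finsupp.sum_of_support_subset t ht _ (by simp)]

lemma crossing_add_left (s s' t : Deg) : crossing (s + s') t = crossing s t + crossing s' t := by
  classical
  let S := (s.support ∪ s'.support) ∪ t.support
  have h1 : s.support ⊆ S := fun x hx => by simp only [S, Finset.mem_union]; tauto
  have h2 : s'.support ⊆ S := fun x hx => by simp only [S, Finset.mem_union]; tauto
  have h3 : t.support ⊆ S := fun x hx => by simp only [S, Finset.mem_union]; tauto
  have h4 : (s + s').support ⊆ S := Finsupp.support_add.trans (Finset.union_subset h1 h2)
  rw [crossing_eq _ _ S h4 h3, crossing_eq _ _ S h1 h3, crossing_eq _ _ S h2 h3,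
    ← Finset.sum_add_distrib]
  refine Finset.sum_congr rfl fun i _ => ?_
  rw [← Finset.sum_add_distrib]
  refine Finset.sum_congr rfl fun j _ => ?_
  split_ifs <;> simp [add_mul]

lemma crossing_add_right (s t t' : Deg) : crossing s (t + t') = crossing s t + crossing s t' := by
  classical
  let S := (t.support ∪ t'.support) ∪ s.support
  have h1 : t.support ⊆ S := fun x hx => by simp only [S, Finset.mem_union]; tauto
  have h2 : t'.support ⊆ S := fun x hx => by simp only [S, Finset.mem_union]; tauto
  have h3 : s.support ⊆ S := fun x hx => by simp only [S, Finset.mem_union]; tauto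
  have h4 : (t + t').support ⊆ S := Finsupp.support_add.trans (Finset.union_subset h1 h2)
  rw [crossing_eq _ _ S h3 h4, crossing_eq _ _ S h3 h1, crossing_eq _ _ S h3 h2,
    ← Finset.sum_add_distrib]
  refine Finset.sum_congr rfl fun i _ => ?_
  rw [← Finset.sum_add_distrib]
  refine Finset.sum_congr rfl fun j _ => ?_
  split_ifs <;> simp [mul_add]

lemma crossing_zero_left (t : Deg) : crossing 0 t = 0 := by simp [crossing]

lemma crossing_zero_right (s : Deg) : crossing s 0 = 0 := by simp [crossing]

lemma crossing_single_right (s : Deg) (n : ℕ) (e : ZMod 2) (h : ∀ i, n < i → s i = 0) :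
    crossing s (Finsupp.single n e) = 0 := by
  unfold crossing
  refine Finset.sum_eq_zero fun i hi => ?_
  refine (Finsupp.sum_single_index (by simp)).trans (if_neg ?_)
  intro hn
  exact (Finsupp.mem_support_iff.1 hi) (h i hn)

variable {A : Type*} [CStarAlgebra A]

/-- The homogeneous component of degree `e`: the even part for `e = 0`, the odd part for `e = 1`. -/
def Grading.part (g : Grading A) (e : ZMod 2) : Submodule ℂ A where
  carrier := {a | g.θ a = sgn e • a}
  add_mem' := by
    intro a b ha hb
    simp only [Set.mem_ofPred_eq] at *
    rw [map_add, ha, hb, smul_add]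
  zero_mem' := by simp
  smul_mem' := by
    intro c a ha
    simp only [Set.mem_ofPred_eq] at *
    rw [map_smul, ha, smul_comm]

lemma Grading.mem_part (g : Grading A) {e : ZMod 2} {a : A} :
    a ∈ g.part e ↔ g.θ a = sgn e • a := Iff.rfl

lemma Grading.one_mem (g : Grading A) : (1 : A) ∈ g.part 0 := by
  simp [g.mem_part, sgn_zero]

lemma Grading.mul_mem (g : Grading A) {d e : ZMod 2} {a b : A} (ha : a ∈ g.part d)
    (hb : b ∈ g.part e) : a * b ∈ g.part (d + e) := by
  rw [g.mem_part] at *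
  rw [map_mul, ha, hb, sgn_add, smul_mul_smul_comm]

lemma Grading.star_mem (g : Grading A) {e : ZMod 2} {a : A} (ha : a ∈ g.part e) :
    star a ∈ g.part e := by
  rw [g.mem_part] at *
  rw [map_star, ha, star_smul]
  congr 1
  exact conj_sgn e

/-- The projection of `A` onto its homogeneous component of degree `e`. -/
def Grading.proj (g : Grading A) (e : ZMod 2) : A →ₗ[ℂ] A where
  toFun a := (2⁻¹ : ℂ) • (a + sgn e • g.θ a)
  map_add' a b := by rw [map_add]; module
  map_smul' c a := by rw [map_smul]; simp only [RingHom.id_apply]; module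

lemma Grading.proj_apply (g : Grading A) (e : ZMod 2) (a : A) :
    g.proj e a = (2⁻¹ : ℂ) • (a + sgn e • g.θ a) := rfl

lemma Grading.proj_mem (g : Grading A) (e : ZMod 2) (a : A) : g.proj e a ∈ g.part e := by
  rw [g.mem_part, g.proj_apply, map_smul, map_add, map_smul, g.invol]
  rw [smul_comm (sgn e) (2⁻¹ : ℂ), smul_add (sgn e), smul_smul (sgn e) (sgn e), sgn_mul_self,
    one_smul, add_comm]

lemma Grading.proj_of_mem (g : Grading A) {e : ZMod 2} {a : A} (ha : a ∈ g.part e) :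
    g.proj e a = a := by
  rw [g.mem_part] at ha
  rw [g.proj_apply, ha, smul_smul, sgn_mul_self, one_smul, ← two_smul ℂ a, smul_smul]
  norm_num

lemma Grading.proj_of_mem' (g : Grading A) {e : ZMod 2} {a : A} (ha : a ∈ g.part e) :
    g.proj (e + 1) a = 0 := by
  rw [g.mem_part] at ha
  rw [g.proj_apply, ha, smul_smul, sgn_add, sgn_one]
  have : sgn e * -1 * sgn e = -1 := by
    have := sgn_mul_self e
    linear_combination -this
  rw [this]; simp

lemma Grading.proj_add_proj (g : Grading A) (a : A) : g.proj 0 a + g.proj 1 a = a := by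
  rw [g.proj_apply, g.proj_apply, sgn_zero, sgn_one]
  module

variable (A) in
/-- The tensor product over `ℕ` of the vector space `A` with itself. It is equipped with
Mathlib's ungraded factorwise product. -/
abbrev Tens : Type _ := ⨂[ℂ] _ : ℕ, A

/-- The factorwise (ungraded) involution on `Tens A`. -/
def tstar : Tens A →+ Tens A :=
  PiTensorProduct.liftAddHom
    (fun p : ℂ × (ℕ → A) => (starRingEnd ℂ p.1) • PiTensorProduct.tprod ℂ (fun i => star (p.2 i)))
    (by
      intro r f i h
      have : (PiTensorProduct.tprod ℂ) (fun i => star (f i)) = 0 :=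
        MultilinearMap.map_coord_zero _ i (by simp [h])
      simp [this])
    (by simp)
    (by
      intro _ r f i a b
      have key : ∀ m : A, (fun k => star (Function.update f i m k))
          = Function.update (fun k => star (f k)) i (star m) := by
        intro m; ext k
        by_cases hk : k = i
        · subst hk; simp
        · simp [hk]
      simp only [key, star_add, MultilinearMap.map_update_add, smul_add])
    (by intro r r' f; simp [add_smul])
    (by
      intro _ r f i r'
      have key : ∀ m : A, (fun k => star (Function.update f i m k))
          = Function.update (fun k => star (f k)) i (star m) := by
        intro m; ext k
        by_cases hk : k = i
        · subst hk; simp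
        · simp [hk]
      simp only [key, star_smul, MultilinearMap.map_update_smul]
      rw [map_mul, mul_comm, mul_smul]
      congr 2
      have h := key (f i)
      rw [Function.update_eq_self] at h
      rw [← h])

lemma tstar_smul_tprod (c : ℂ) (a : ℕ → A) :
    tstar (c • PiTensorProduct.tprod ℂ a)
      = (starRingEnd ℂ c) • PiTensorProduct.tprod ℂ (fun i => star (a i)) := by
  rw [← PiTensorProduct.tprodCoeff_eq_smul_tprod]
  rfl

lemma tstar_tprod (a : ℕ → A) :
    tstar (PiTensorProduct.tprod ℂ a) = PiTensorProduct.tprod ℂ (fun i => star (a i)) := by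
  simpa using tstar_smul_tprod 1 a

lemma tstar_smul (c : ℂ) (x : Tens A) : tstar (c • x) = (starRingEnd ℂ c) • tstar x := by
  induction x using PiTensorProduct.induction_on with
  | smul_tprod r f => rw [smul_smul, tstar_smul_tprod, tstar_smul_tprod, map_mul, smul_smul]
  | add x y hx hy => rw [smul_add, map_add, map_add, hx, hy, smul_add]

lemma tstar_tstar (x : Tens A) : tstar (tstar x) = x := by
  induction x using PiTensorProduct.induction_on with
  | smul_tprod r f => simp [tstar_smul_tprod]
  | add x y hx hy => rw [map_add, map_add, hx, hy]

lemma tstar_mul (x y : Tens A) : tstar (x * y) = tstar y * tstar x := by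
  induction x using PiTensorProduct.induction_on with
  | add x x' hx hx' => rw [add_mul, map_add, map_add, hx, hx', mul_add]
  | smul_tprod r f =>
    induction y using PiTensorProduct.induction_on with
    | add x x' hx hx' => rw [mul_add, map_add, map_add, hx, hx', add_mul]
    | smul_tprod r' f' =>
      rw [PiTensorProduct.smul_tprod_mul_smul_tprod, tstar_smul_tprod, tstar_smul_tprod,
        tstar_smul_tprod, PiTensorProduct.smul_tprod_mul_smul_tprod, map_mul, mul_comm]
      congr 2
      ext i
      simp

/-- The elementary tensors `a 0 ⊗ a 1 ⊗ ⋯ ⊗ 1 ⊗ 1 ⊗ ⋯` with `a i` homogeneous of degree `s i`. -/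
def homTensors (g : Grading A) (s : Deg) : Set (Tens A) :=
  {x | ∃ a : ℕ → A, (∀ i, a i ∈ g.part (s i)) ∧ (∃ n, ∀ i, n ≤ i → a i = 1) ∧
    x = PiTensorProduct.tprod ℂ a}

/-- The component of degree `s` of the algebraic infinite tensor product: the span of all
elementary tensors that are homogeneous of degree `s`. -/
def comp (g : Grading A) (s : Deg) : Submodule ℂ (Tens A) := Submodule.span ℂ (homTensors g s)

lemma one_mem_comp (g : Grading A) : (1 : Tens A) ∈ comp g 0 :=
  Submodule.subset_span ⟨1, fun _ => g.one_mem, ⟨0, fun _ _ => rfl⟩, rfl⟩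

lemma mul_mem_comp (g : Grading A) {s t : Deg} {x y : Tens A} (hx : x ∈ comp g s)
    (hy : y ∈ comp g t) : x * y ∈ comp g (s + t) := by
  induction hx using Submodule.span_induction with
  | zero => rw [zero_mul]; exact zero_mem _
  | add x x' _ _ h h' => rw [add_mul]; exact add_mem h h'
  | smul c x _ h => rw [smul_mul_assoc]; exact Submodule.smul_mem _ _ h
  | mem x hx =>
    induction hy using Submodule.span_induction with
    | zero => rw [mul_zero]; exact zero_mem _
    | add x x' _ _ h h' => rw [mul_add]; exact add_mem h h'
    | smul c x _ h => rw [mul_smul_comm]; exact Submodule.smul_mem _ _ h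
    | mem y hy =>
      obtain ⟨a, ha, ⟨n, hn⟩, rfl⟩ := hx
      obtain ⟨b, hb, ⟨m, hm⟩, rfl⟩ := hy
      rw [PiTensorProduct.tprod_mul_tprod]
      refine Submodule.subset_span ⟨a * b, fun i => g.mul_mem (ha i) (hb i), ⟨max n m, ?_⟩, rfl⟩
      intro i hi
      rw [Pi.mul_apply, hn i (le_trans (le_max_left _ _) hi),
        hm i (le_trans (le_max_right _ _) hi), one_mul]

lemma tstar_mem_comp (g : Grading A) {s : Deg} {x : Tens A} (hx : x ∈ comp g s) :
    tstar x ∈ comp g s := by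
  induction hx using Submodule.span_induction with
  | zero => rw [map_zero]; exact zero_mem _
  | add x x' _ _ h h' => rw [map_add]; exact add_mem h h'
  | smul c x _ h => rw [tstar_smul]; exact Submodule.smul_mem _ _ h
  | mem x hx =>
    obtain ⟨a, ha, ⟨n, hn⟩, rfl⟩ := hx
    rw [tstar_tprod]
    refine Submodule.subset_span ⟨fun i => star (a i), fun i => g.star_mem (ha i), ⟨n, ?_⟩, rfl⟩
    intro i hi
    simp [hn i hi]

/-- The homogeneous component of degree `s`, as a type. -/
def Comp (g : Grading A) (s : Deg) : Type _ := comp g s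

instance (g : Grading A) (s : Deg) : AddCommGroup (Comp g s) :=
  inferInstanceAs (AddCommGroup (comp g s))

instance (g : Grading A) (s : Deg) : Module ℂ (Comp g s) :=
  inferInstanceAs (Module ℂ (comp g s))

/-- The Fermi product on homogeneous components: the factorwise product, multiplied by the sign
`∏_{j < i} (-1) ^ (s i * t j)`. -/
instance (g : Grading A) : GradedMonoid.GMul (Comp g) where
  mul {s t} x y := ⟨sgn (crossing s t) • (x.1 * y.1),
    Submodule.smul_mem _ _ (mul_mem_comp g x.2 y.2)⟩

instance (g : Grading A) : GradedMonoid.GOne (Comp g) where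
  one := ⟨1, one_mem_comp g⟩

instance (g : Grading A) : DirectSum.GRing (Comp g) where
  mul_zero {s t} x := Subtype.ext (by
    change sgn _ • (x.1 * 0) = 0
    simp)
  zero_mul {s t} x := Subtype.ext (by
    change sgn _ • (0 * x.1) = 0
    simp)
  mul_add {s t} x y z := Subtype.ext (by
    change sgn _ • (x.1 * (y.1 + z.1)) = sgn _ • (x.1 * y.1) + sgn _ • (x.1 * z.1)
    rw [mul_add, smul_add])
  add_mul {s t} x y z := Subtype.ext (by
    change sgn _ • ((x.1 + y.1) * z.1) = sgn _ • (x.1 * z.1) + sgn _ • (y.1 * z.1)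
    rw [add_mul, smul_add])
  one_mul := by
    rintro ⟨s, x⟩
    refine Sigma.subtype_ext (zero_add s) ?_
    change sgn (crossing 0 s) • (1 * x.1) = x.1
    rw [crossing_zero_left, sgn_zero, one_smul, one_mul]
  mul_one := by
    rintro ⟨s, x⟩
    refine Sigma.subtype_ext (add_zero s) ?_
    change sgn (crossing s 0) • (x.1 * 1) = x.1
    rw [crossing_zero_right, sgn_zero, one_smul, mul_one]
  mul_assoc := by
    rintro ⟨s, x⟩ ⟨t, y⟩ ⟨u, z⟩
    refine Sigma.subtype_ext (add_assoc s t u) ?_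
    change sgn (crossing (s + t) u) • ((sgn (crossing s t) • (x.1 * y.1)) * z.1)
      = sgn (crossing s (t + u)) • (x.1 * (sgn (crossing t u) • (y.1 * z.1)))
    rw [smul_mul_assoc, mul_smul_comm, smul_smul, smul_smul, mul_assoc, ← sgn_add, ← sgn_add,
      crossing_add_left, crossing_add_right]
    congr 2
    ring
  natCast n := n • (⟨1, one_mem_comp g⟩ : comp g 0)
  natCast_zero := zero_nsmul _
  natCast_succ n := succ_nsmul _ n
  intCast n := n • (⟨1, one_mem_comp g⟩ : comp g 0)
  intCast_ofNat n := natCast_zsmul _ n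
  intCast_negSucc_ofNat n := negSucc_zsmul _ n

/-- The algebraic infinite Fermi tensor product of `(A, θ)` with itself, as the direct sum of its
homogeneous components `comp g s`, with the Fermi product and the Fermi involution. -/
def Alg (g : Grading A) : Type _ := ⨁ s, Comp g s

instance (g : Grading A) : Ring (Alg g) := inferInstanceAs (Ring (⨁ s, Comp g s))

instance (g : Grading A) : Module ℂ (Alg g) := inferInstanceAs (Module ℂ (⨁ s, Comp g s))

/-- The inclusion of the component of degree `s`. -/
def incl (g : Grading A) (s : Deg) : comp g s →ₗ[ℂ] Alg g := DirectSum.lof ℂ Deg (Comp g) s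

lemma incl_congr (g : Grading A) {s t : Deg} (h : s = t) {x : comp g s} {y : comp g t}
    (hxy : (x : Tens A) = y) : incl g s x = incl g t y := by
  subst h
  rw [Subtype.ext hxy]

lemma incl_mul (g : Grading A) {s t : Deg} (x : comp g s) (y : comp g t) :
    incl g s x * incl g t y
      = sgn (crossing s t) • incl g (s + t) ⟨x.1 * y.1, mul_mem_comp g x.2 y.2⟩ := by
  rw [← map_smul]
  exact DirectSum.of_mul_of (A := Comp g) x y

lemma incl_one (g : Grading A) : incl g 0 ⟨1, one_mem_comp g⟩ = 1 := rfl

lemma alg_induction (g : Grading A) {p : Alg g → Prop} (x : Alg g) (h0 : p 0)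
    (hadd : ∀ x y, p x → p y → p (x + y)) (hi : ∀ s (x : comp g s), p (incl g s x)) : p x :=
  DirectSum.induction_on (motive := p) x h0 hi hadd

instance (g : Grading A) : Algebra ℂ (Alg g) :=
  Algebra.ofModule
    (by
      intro r x y
      induction x using alg_induction with
      | h0 => simp
      | hadd x x' h h' => rw [smul_add, add_mul, add_mul, h, h', smul_add]
      | hi s x =>
        induction y using alg_induction with
        | h0 => simp
        | hadd x x' h h' => rw [mul_add, mul_add, h, h', smul_add]
        | hi t y =>
          rw [← map_smul, incl_mul, incl_mul, smul_comm r, ← map_smul (incl g _) r]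
          congr 1
          exact incl_congr g rfl (smul_mul_assoc r x.1 y.1))
    (by
      intro r x y
      induction x using alg_induction with
      | h0 => simp
      | hadd x x' h h' => rw [add_mul, add_mul, h, h', smul_add]
      | hi s x =>
        induction y using alg_induction with
        | h0 => simp
        | hadd x x' h h' => rw [smul_add, mul_add, mul_add, h, h', smul_add]
        | hi t y =>
          rw [← map_smul, incl_mul, incl_mul, smul_comm r, ← map_smul (incl g _) r]
          congr 1
          exact incl_congr g rfl (mul_smul_comm r x.1 y.1))

/-- The Fermi involution on the component of degree `s`: the factorwise involution, multiplied by
the sign `∏_{j < i} (-1) ^ (s i * s j)`. -/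
def compStar (g : Grading A) (s : Deg) : Comp g s →+ Comp g s where
  toFun x := ⟨sgn (crossing s s) • tstar x.1, Submodule.smul_mem _ _ (tstar_mem_comp g x.2)⟩
  map_zero' := Subtype.ext (by
    change sgn _ • tstar 0 = 0
    simp)
  map_add' x y := Subtype.ext (by
    change sgn _ • tstar (x.1 + y.1) = sgn _ • tstar x.1 + sgn _ • tstar y.1
    rw [map_add, smul_add])

instance (g : Grading A) : Star (Alg g) := ⟨DirectSum.map (compStar g)⟩

lemma star_incl (g : Grading A) {s : Deg} (x : comp g s) :
    star (incl g s x) = sgn (crossing s s) • incl g s ⟨tstar x.1, tstar_mem_comp g x.2⟩ := by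
  rw [← map_smul]
  exact DirectSum.map_of (compStar g) s x

lemma alg_star_add (g : Grading A) (x y : Alg g) : star (x + y) = star x + star y :=
  map_add (DirectSum.map (compStar g)) x y

lemma alg_star_zero (g : Grading A) : star (0 : Alg g) = 0 :=
  map_zero (DirectSum.map (compStar g))

lemma alg_star_smul (g : Grading A) (c : ℂ) (x : Alg g) :
    star (c • x) = (starRingEnd ℂ c) • star x := by
  induction x using alg_induction with
  | h0 => simp [alg_star_zero]
  | hadd x x' h h' => rw [smul_add, alg_star_add, alg_star_add, h, h', smul_add]
  | hi s x =>
    rw [← map_smul, star_incl, star_incl, smul_comm]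
    refine congrArg _ ?_
    rw [← map_smul]
    exact incl_congr g rfl (tstar_smul c x.1)

instance (g : Grading A) : StarRing (Alg g) where
  star_involutive x := by
    induction x using alg_induction with
    | h0 => simp [alg_star_zero]
    | hadd x x' h h' => rw [alg_star_add, alg_star_add, h, h']
    | hi s x =>
      rw [star_incl, alg_star_smul, star_incl, smul_smul, conj_sgn, sgn_mul_self, one_smul]
      exact incl_congr g rfl (tstar_tstar x.1)
  star_add := alg_star_add g
  star_mul x y := by
    induction x using alg_induction with
    | h0 => simp [alg_star_zero]
    | hadd x x' h h' => rw [add_mul, alg_star_add, alg_star_add, h, h', mul_add]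
    | hi s x =>
      induction y using alg_induction with
      | h0 => simp [alg_star_zero]
      | hadd x x' h h' => rw [mul_add, alg_star_add, alg_star_add, h, h', add_mul]
      | hi t y =>
        rw [incl_mul, alg_star_smul, star_incl, star_incl, star_incl, smul_mul_smul_comm, incl_mul,
          smul_smul, smul_smul, conj_sgn, ← sgn_add, ← sgn_add, ← sgn_add]
        have h : crossing s t + crossing (s + t) (s + t)
            = crossing t t + crossing s s + crossing t s := by
          have h2 : crossing s t + crossing s t = 0 := CharTwo.add_self_eq_zero _
          rw [crossing_add_left, crossing_add_right, crossing_add_right]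
          linear_combination h2
        rw [h]
        congr 1
        exact incl_congr g (add_comm s t) (tstar_mul x.1 y.1)

instance (g : Grading A) : StarModule ℂ (Alg g) where
  star_smul c x := alg_star_smul g c x

lemma update_one_mem (g : Grading A) (j : ℕ) {e : ZMod 2} {a : A} (ha : a ∈ g.part e) :
    PiTensorProduct.tprod ℂ (Function.update (1 : ℕ → A) j a)
      ∈ comp g (Finsupp.single j e) := by
  refine Submodule.subset_span ⟨_, fun i => ?_, ⟨j + 1, fun i hi => ?_⟩, rfl⟩
  · by_cases h : i = j
    · subst h; simpa using ha
    · simpa [h, Finsupp.single_apply, Ne.symm h] using g.one_mem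
  · have h : i ≠ j := by omega
    simp [h]

/-- The homogeneous part of degree `e` of the embedding of `A` as the `j`-th tensor factor. -/
def embPart (g : Grading A) (j : ℕ) (e : ZMod 2) : A →ₗ[ℂ] Alg g :=
  incl g (Finsupp.single j e) ∘ₗ LinearMap.codRestrict _
    ((PiTensorProduct.tprod ℂ).toLinearMap (1 : ℕ → A) j ∘ₗ g.proj e)
    (fun a => update_one_mem g j (g.proj_mem e a))

/-- The embedding `a ↦ 1 ⊗ ⋯ ⊗ 1 ⊗ a ⊗ 1 ⊗ ⋯` of `A` as the `j`-th tensor factor. -/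
def embLin (g : Grading A) (j : ℕ) : A →ₗ[ℂ] Alg g := embPart g j 0 + embPart g j 1

lemma embLin_of_mem (g : Grading A) (j : ℕ) {e : ZMod 2} {a : A} (ha : a ∈ g.part e) :
    embLin g j a = incl g (Finsupp.single j e) ⟨_, update_one_mem g j ha⟩ := by
  have h1 : embPart g j (e + 1) a = 0 := by
    simp only [embPart, LinearMap.comp_apply]
    convert map_zero (incl g (Finsupp.single j (e + 1)))
    refine Subtype.ext ?_
    change (PiTensorProduct.tprod ℂ) (Function.update (1 : ℕ → A) j (g.proj (e + 1) a)) = 0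
    rw [g.proj_of_mem' ha]
    exact MultilinearMap.map_coord_zero _ j (by simp)
  have h2 : embPart g j e a = incl g (Finsupp.single j e) ⟨_, update_one_mem g j ha⟩ := by
    simp only [embPart, LinearMap.comp_apply]
    refine incl_congr g rfl ?_
    change (PiTensorProduct.tprod ℂ) (Function.update (1 : ℕ → A) j (g.proj e a)) = _
    rw [g.proj_of_mem ha]
  have h3 : (1 : ZMod 2) + 1 = 0 := by decide
  rw [embLin, LinearMap.add_apply, ← h2]
  rcases deg_cases e with rfl | rfl
  · rw [zero_add] at h1
    rw [h1, add_zero]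
  · rw [h3] at h1
    rw [h1, zero_add]

lemma embLin_mul (g : Grading A) (j : ℕ) (a b : A) :
    embLin g j (a * b) = embLin g j a * embLin g j b := by
  have key : ∀ (d e : ZMod 2) (a b : A), a ∈ g.part d → b ∈ g.part e →
      embLin g j (a * b) = embLin g j a * embLin g j b := by
    intro d e a b ha hb
    rw [embLin_of_mem g j ha, embLin_of_mem g j hb, embLin_of_mem g j (g.mul_mem ha hb), incl_mul,
      crossing_single_right _ _ _ (fun i hi => by simp [hi.ne]), sgn_zero,
      one_smul]
    refine incl_congr g (Finsupp.single_add j d e) ?_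
    change _ = (PiTensorProduct.tprod ℂ) _ * (PiTensorProduct.tprod ℂ) _
    rw [PiTensorProduct.tprod_mul_tprod]
    refine congrArg (PiTensorProduct.tprod ℂ) (funext fun i => ?_)
    by_cases h : i = j
    · subst h; simp
    · simp [h]
  rw [← g.proj_add_proj a, ← g.proj_add_proj b]
  simp only [add_mul, mul_add, map_add]
  simp only [key _ _ _ _ (g.proj_mem _ a) (g.proj_mem _ b)]

lemma embLin_star (g : Grading A) (j : ℕ) (a : A) :
    embLin g j (star a) = star (embLin g j a) := by
  have key : ∀ (e : ZMod 2) (a : A), a ∈ g.part e →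
      embLin g j (star a) = star (embLin g j a) := by
    intro e a ha
    rw [embLin_of_mem g j ha, embLin_of_mem g j (g.star_mem ha), star_incl,
      crossing_single_right _ _ _ (fun i hi => by simp [hi.ne]), sgn_zero,
      one_smul]
    refine incl_congr g rfl ?_
    change _ = tstar ((PiTensorProduct.tprod ℂ) _)
    rw [tstar_tprod]
    refine congrArg (PiTensorProduct.tprod ℂ) (funext fun i => ?_)
    by_cases h : i = j
    · subst h; simp
    · simp [h]
  rw [← g.proj_add_proj a]
  simp only [star_add, map_add]
  simp only [key _ _ (g.proj_mem _ a)]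

lemma embLin_one (g : Grading A) (j : ℕ) : embLin g j 1 = 1 := by
  rw [embLin_of_mem g j g.one_mem, ← incl_one]
  refine incl_congr g (Finsupp.single_zero j) ?_
  change (PiTensorProduct.tprod ℂ) _ = (PiTensorProduct.tprod ℂ) _
  congr 1
  simp

/-- The embedding `a ↦ 1 ⊗ ⋯ ⊗ 1 ⊗ a ⊗ 1 ⊗ ⋯` of `A` as the `j`-th tensor factor, as a unital
`*`-homomorphism. -/
def emb (g : Grading A) (j : ℕ) : A →⋆ₐ[ℂ] Alg g where
  __ := AlgHom.ofLinearMap (embLin g j) (embLin_one g j) (embLin_mul g j)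
  map_star' := embLin_star g j

lemma emb_of_mem (g : Grading A) (j : ℕ) {e : ZMod 2} {a : A} (ha : a ∈ g.part e) :
    emb g j a = incl g (Finsupp.single j e) ⟨_, update_one_mem g j ha⟩ := embLin_of_mem g j ha

/-- The elementary tensor `a 0 ⊗ a 1 ⊗ ⋯ ⊗ a (n - 1) ⊗ 1 ⊗ 1 ⊗ ⋯`, which in the Fermi tensor
product is the ordered product of the embedded factors. -/
def elem (g : Grading A) (a : ℕ → A) : ℕ → Alg g
  | 0 => 1
  | n + 1 => elem g a n * emb g n (a n)

/-- The truncation of a family of degrees to the first `n` factors. -/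
def trunc (s : Deg) (n : ℕ) : Deg := s.filter (fun i => i < n)

lemma trunc_apply (s : Deg) (n i : ℕ) : trunc s n i = if i < n then s i else 0 := by
  simp [trunc, Finsupp.filter_apply]

lemma trunc_tensor_mem (g : Grading A) {s : Deg} {a : ℕ → A} (ha : ∀ i, a i ∈ g.part (s i))
    (n : ℕ) : PiTensorProduct.tprod ℂ (fun i => if i < n then a i else 1)
      ∈ comp g (trunc s n) := by
  refine Submodule.subset_span ⟨_, fun i => ?_, ⟨n, fun i hi => ?_⟩, rfl⟩
  · rw [trunc_apply]
    split_ifs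
    · exact ha i
    · exact g.one_mem
  · simp [not_lt.2 hi]

/-- For homogeneous factors, `elem` is the elementary tensor itself. -/
lemma elem_eq (g : Grading A) {s : Deg} {a : ℕ → A} (ha : ∀ i, a i ∈ g.part (s i)) (n : ℕ) :
    elem g a n = incl g (trunc s n) ⟨_, trunc_tensor_mem g ha n⟩ := by
  induction n with
  | zero =>
    rw [elem, ← incl_one]
    refine incl_congr g (by ext i; simp [trunc_apply]) ?_
    change (PiTensorProduct.tprod ℂ) _ = (PiTensorProduct.tprod ℂ) _
    refine congrArg _ (funext fun i => ?_)
    simp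
  | succ n ih =>
    rw [elem, ih, emb_of_mem g n (ha n), incl_mul,
      crossing_single_right _ _ _ (fun i hi => by simp [trunc_apply, not_lt.2 hi.le]), sgn_zero,
      one_smul]
    refine incl_congr g ?_ ?_
    · ext i
      rw [Finsupp.add_apply, trunc_apply, trunc_apply, Finsupp.single_apply]
      rcases lt_trichotomy i n with h | h | h
      · simp [h, h.ne', h.trans (Nat.lt_succ_self n)]
      · subst h; simp
      · simp [h.ne, not_lt.2 h.le, not_lt.2 (Nat.succ_le_of_lt h)]
    · change (PiTensorProduct.tprod ℂ) _ * (PiTensorProduct.tprod ℂ) _ = (PiTensorProduct.tprod ℂ) _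
      rw [PiTensorProduct.tprod_mul_tprod]
      refine congrArg _ (funext fun i => ?_)
      rw [Pi.mul_apply]
      rcases lt_trichotomy i n with h | h | h
      · simp [h, h.ne, h.trans (Nat.lt_succ_self n)]
      · subst h; simp
      · simp [h.ne', not_lt.2 h.le, not_lt.2 (Nat.succ_le_of_lt h)]

/-- The algebraic Fermi tensor product is generated by the embedded tensor factors. -/
lemma gen_induction (g : Grading A) {p : Alg g → Prop} (hadd : ∀ x y, p x → p y → p (x + y))
    (hmul : ∀ x y, p x → p y → p (x * y)) (hsmul : ∀ (c : ℂ) x, p x → p (c • x))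
    (hemb : ∀ j a, p (emb g j a)) (x : Alg g) : p x := by
  have h1 : p 1 := by simpa using hemb 0 1
  have h0 : p 0 := by simpa using hsmul 0 1 h1
  have helem : ∀ a n, p (elem g a n) := by
    intro a n
    induction n with
    | zero => exact h1
    | succ n ih => exact hmul _ _ ih (hemb _ _)
  induction x using alg_induction with
  | h0 => exact h0
  | hadd x x' h h' => exact hadd _ _ h h'
  | hi s x =>
    obtain ⟨x, hx⟩ := x
    induction hx using Submodule.span_induction with
    | zero => 
      convert h0
      exact map_zero (incl g s)
    | add x y hx hy h h' => 
      convert hadd _ _ h h'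
      exact map_add (incl g s) ⟨x, hx⟩ ⟨y, hy⟩
    | smul c x hx h =>
      convert hsmul c _ h
      exact map_smul (incl g s) c ⟨x, hx⟩
    | mem x hx =>
      obtain ⟨a, ha, ⟨n, hn⟩, rfl⟩ := hx
      obtain ⟨m, hm⟩ : ∃ m, ∀ i, m ≤ i → s i = 0 := by
        refine ⟨s.support.sup id + 1, fun i hi => ?_⟩
        by_contra h
        have := Finset.le_sup (f := id) (Finsupp.mem_support_iff.2 h)
        simp only [id] at this
        omega
      convert helem a (max n m)
      rw [elem_eq g ha]
      refine incl_congr g ?_ ?_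
      · ext i
        rw [trunc_apply]
        split_ifs with h
        · rfl
        · exact hm i (by omega)
      · change (PiTensorProduct.tprod ℂ) _ = (PiTensorProduct.tprod ℂ) _
        refine congrArg _ (funext fun i => ?_)
        split_ifs with h
        · rfl
        · exact hn i (by omega)

lemma algHom_ext' (g : Grading A) {D : Type*} [Semiring D] [Algebra ℂ D] {f f' : Alg g →ₐ[ℂ] D}
    (h : ∀ j a, f (emb g j a) = f' (emb g j a)) : f = f' := by
  ext x
  induction x using gen_induction with
  | hadd x y h h' => rw [map_add, map_add, h, h']
  | hmul x y h h' => rw [map_mul, map_mul, h, h']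
  | hsmul c x h => rw [map_smul, map_smul, h]
  | hemb j a => exact h j a

/-- A state on a unital complex `*`-algebra: a positive linear functional with `φ 1 = 1`. -/
structure IsState {D : Type*} [Ring D] [StarRing D] [Algebra ℂ D] (φ : D →ₗ[ℂ] ℂ) : Prop where
  nonneg : ∀ x, 0 ≤ φ (star x * x)
  map_one : φ 1 = 1

lemma IsState.map_star {D : Type*} [Ring D] [StarRing D] [Algebra ℂ D] [StarModule ℂ D]
    {φ : D →ₗ[ℂ] ℂ} (h : IsState φ) (x : D) : φ (star x) = starRingEnd ℂ (φ x) := by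
  have h1 := (Complex.le_def.1 (h.nonneg x)).2
  have h2 := (Complex.le_def.1 (h.nonneg (1 + x))).2
  have h3 := (Complex.le_def.1 (h.nonneg (1 + Complex.I • x))).2
  have h4 := h.map_one
  simp only [star_add, star_one, add_mul, mul_add, one_mul, mul_one, map_add, star_smul,
    smul_mul_assoc, mul_smul_comm, map_smul, h4, Complex.add_im, Complex.star_def,
    Complex.conj_I, smul_eq_mul, Complex.mul_im, Complex.mul_re, Complex.one_im, Complex.zero_im,
    Complex.neg_re, Complex.neg_im, Complex.I_re, Complex.I_im, neg_mul, one_mul] at *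
  apply Complex.ext
  · simp only [Complex.conj_re]; linarith
  · simp only [Complex.conj_im]; linarith

variable {g : Grading A}

/-- The norm constant of left multiplication by `x` in the GNS representations of all states. -/
lemma exists_bound (x : Alg g) : ∃ C : ℝ, 0 ≤ C ∧ ∀ φ : Alg g →ₗ[ℂ] ℂ, IsState φ → ∀ y,
    (φ (star (x * y) * (x * y))).re ≤ C * (φ (star y * y)).re := by
  have hadd : ∀ x x' : Alg g, (∃ C : ℝ, 0 ≤ C ∧ ∀ φ : Alg g →ₗ[ℂ] ℂ, IsState φ → ∀ y,
      (φ (star (x * y) * (x * y))).re ≤ C * (φ (star y * y)).re) →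
      (∃ C : ℝ, 0 ≤ C ∧ ∀ φ : Alg g →ₗ[ℂ] ℂ, IsState φ → ∀ y,
      (φ (star (x' * y) * (x' * y))).re ≤ C * (φ (star y * y)).re) →
      (∃ C : ℝ, 0 ≤ C ∧ ∀ φ : Alg g →ₗ[ℂ] ℂ, IsState φ → ∀ y,
      (φ (star ((x + x') * y) * ((x + x') * y))).re ≤ C * (φ (star y * y)).re) := by
    rintro x x' ⟨C, hC, h⟩ ⟨C', hC', h'⟩
    refine ⟨2 * C + 2 * C', by positivity, fun φ hφ y => ?_⟩
    have h1 := h φ hφ y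
    have h2 := h' φ hφ y
    have h3 := (Complex.le_def.1 (hφ.nonneg (x * y - x' * y))).1
    have h4 : star ((x + x') * y) * ((x + x') * y) = (2 : ℂ) • (star (x * y) * (x * y))
        + (2 : ℂ) • (star (x' * y) * (x' * y))
        - star (x * y - x' * y) * (x * y - x' * y) := by
      rw [add_mul, star_add, star_sub]
      generalize x * y = a
      generalize x' * y = b
      rw [two_smul, two_smul]
      noncomm_ring
    rw [h4, map_sub, map_add, map_smul, map_smul]
    simp only [Complex.sub_re, Complex.add_re, smul_eq_mul, Complex.mul_re, Complex.re_ofNat,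
      Complex.im_ofNat, zero_mul, sub_zero, Complex.zero_re] at *
    nlinarith
  have hsmul : ∀ (c : ℂ) (x : Alg g), (∃ C : ℝ, 0 ≤ C ∧ ∀ φ : Alg g →ₗ[ℂ] ℂ, IsState φ → ∀ y,
      (φ (star (x * y) * (x * y))).re ≤ C * (φ (star y * y)).re) →
      (∃ C : ℝ, 0 ≤ C ∧ ∀ φ : Alg g →ₗ[ℂ] ℂ, IsState φ → ∀ y,
      (φ (star ((c • x) * y) * ((c • x) * y))).re ≤ C * (φ (star y * y)).re) := by
    rintro c x ⟨C, hC, h⟩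
    refine ⟨Complex.normSq c * C, mul_nonneg (Complex.normSq_nonneg c) hC, fun φ hφ y => ?_⟩
    rw [smul_mul_assoc, star_smul, smul_mul_smul_comm, map_smul, Complex.star_def,
      mul_comm (starRingEnd ℂ c), Complex.mul_conj, smul_eq_mul, Complex.re_ofReal_mul, mul_assoc]
    exact mul_le_mul_of_nonneg_left (h φ hφ y) (Complex.normSq_nonneg c)
  induction x using gen_induction with
  | hadd x x' h h' => exact hadd x x' h h'
  | hsmul c x h => exact hsmul c x h
  | hmul x x' h h' =>
    obtain ⟨C, hC, h⟩ := h
    obtain ⟨C', hC', h'⟩ := h'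
    refine ⟨C * C', by positivity, fun φ hφ y => ?_⟩
    have h1 := h φ hφ (x' * y)
    have h2 := mul_le_mul_of_nonneg_left (h' φ hφ y) hC
    rw [mul_assoc x x' y, mul_assoc C C']
    exact h1.trans h2
  | hemb j a =>
    have ha : a ∈ Submodule.span ℂ (unitary A : Set A) := by
      rw [CStarAlgebra.span_unitary]; trivial
    induction ha using Submodule.span_induction with
    | zero => exact ⟨0, le_rfl, fun φ hφ y => by simp⟩
    | add a b _ _ h h' => rw [map_add]; exact hadd _ _ h h'
    | smul c a _ h => rw [map_smul]; exact hsmul _ _ h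
    | mem u hu =>
      refine ⟨1, zero_le_one, fun φ hφ y => ?_⟩
      rw [star_mul, mul_assoc, ← mul_assoc (star _) _ y, ← map_star (emb g j), ← map_mul,
        (Unitary.mem_iff.1 hu).1, map_one, one_mul, one_mul]

/-- The space of the GNS representation of a state on the algebraic Fermi tensor product, before
completion. -/
@[nolint unusedArguments]
def PreGNS {φ : Alg g →ₗ[ℂ] ℂ} (_ : IsState φ) : Type _ := Alg g

section GNS

variable {φ : Alg g →ₗ[ℂ] ℂ} (hφ : IsState φ)

instance : AddCommGroup (PreGNS hφ) := inferInstanceAs (AddCommGroup (Alg g))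

instance : Module ℂ (PreGNS hφ) := inferInstanceAs (Module ℂ (Alg g))

/-- The identity map from the algebra to its GNS space. -/
def toPreGNS : Alg g ≃ₗ[ℂ] PreGNS hφ := LinearEquiv.refl ℂ _

/-- The semi-inner product `⟨x, y⟩ = φ (x* y)`. -/
abbrev gnsCore : PreInnerProductSpace.Core ℂ (PreGNS hφ) where
  inner x y := φ (star ((toPreGNS hφ).symm x) * (toPreGNS hφ).symm y)
  conj_inner_symm x y := by rw [← hφ.map_star, star_mul, star_star]
  re_inner_nonneg x := (Complex.le_def.1 (hφ.nonneg _)).1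
  add_left x y z := by rw [map_add, star_add, add_mul, map_add]
  smul_left x y r := by
    rw [map_smul, star_smul, smul_mul_assoc, map_smul]
    rfl

instance : SeminormedAddCommGroup (PreGNS hφ) :=
  InnerProductSpace.Core.toSeminormedAddCommGroup (c := gnsCore hφ)

instance : InnerProductSpace ℂ (PreGNS hφ) := InnerProductSpace.ofCore (gnsCore hφ)

lemma preGNS_inner (x y : PreGNS hφ) :
    inner ℂ x y = φ (star ((toPreGNS hφ).symm x) * (toPreGNS hφ).symm y) := rfl

lemma preGNS_norm_sq (x : PreGNS hφ) :
    ‖x‖ ^ 2 = (φ (star ((toPreGNS hφ).symm x) * (toPreGNS hφ).symm x)).re := by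
  rw [@norm_sq_eq_re_inner ℂ]
  rfl

/-- The GNS Hilbert space. -/
abbrev GNS : Type _ := UniformSpace.Completion (PreGNS hφ)

/-- Left multiplication by `x` on the GNS space before completion. -/
def leftMul (x : Alg g) : PreGNS hφ →L[ℂ] PreGNS hφ :=
  ((toPreGNS hφ).toLinearMap ∘ₗ LinearMap.mulLeft ℂ x ∘ₗ (toPreGNS hφ).symm.toLinearMap).mkContinuous
    (√(exists_bound x).choose) fun y => by
      have h := (exists_bound x).choose_spec
      rw [← sq_le_sq₀ (by positivity) (by positivity), mul_pow, Real.sq_sqrt h.1, preGNS_norm_sq,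
        preGNS_norm_sq]
      exact h.2 φ hφ _

lemma leftMul_apply (x : Alg g) (y : PreGNS hφ) :
    leftMul hφ x y = toPreGNS hφ (x * (toPreGNS hφ).symm y) := rfl

lemma norm_leftMul_le (x : Alg g) : ‖leftMul hφ x‖ ≤ √(exists_bound x).choose :=
  LinearMap.mkContinuous_norm_le _ (Real.sqrt_nonneg _) _

/-- The GNS representation `x ↦ π_φ x`. -/
def gnsRep : Alg g →⋆ₐ[ℂ] (GNS hφ →L[ℂ] GNS hφ) where
  toFun x := (leftMul hφ x).completion
  map_one' := by
    ext y
    induction y using UniformSpace.Completion.induction_on with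
    | hp => apply isClosed_eq <;> fun_prop
    | ih y => simp [leftMul_apply]
  map_zero' := by
    ext y
    induction y using UniformSpace.Completion.induction_on with
    | hp => apply isClosed_eq <;> fun_prop
    | ih y => simp [leftMul_apply, UniformSpace.Completion.coe_zero]
  map_mul' x x' := by
    ext y
    induction y using UniformSpace.Completion.induction_on with
    | hp => apply isClosed_eq <;> fun_prop
    | ih y => simp [leftMul_apply, mul_assoc]
  map_add' x x' := by
    ext y
    induction y using UniformSpace.Completion.induction_on with
    | hp => apply isClosed_eq <;> fun_prop
    | ih y => simp [leftMul_apply, add_mul, UniformSpace.Completion.coe_add]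
  commutes' r := by
    ext y
    induction y using UniformSpace.Completion.induction_on with
    | hp => apply isClosed_eq <;> fun_prop
    | ih y => simp [leftMul_apply, Algebra.algebraMap_eq_smul_one]
  map_star' x := by
    refine (ContinuousLinearMap.eq_adjoint_iff _ _).mpr ?_
    intro y z
    induction y, z using UniformSpace.Completion.induction_on₂ with
    | hp => apply isClosed_eq <;> fun_prop
    | ih y z => simp [leftMul_apply, mul_assoc, preGNS_inner]

lemma gnsRep_coe (x : Alg g) (y : PreGNS hφ) :
    gnsRep hφ x (y : GNS hφ) = (leftMul hφ x y : PreGNS hφ) :=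
  ContinuousLinearMap.completion_apply_coe _ _

lemma norm_gnsRep_le (x : Alg g) : ‖gnsRep hφ x‖ ≤ √(exists_bound x).choose := by
  refine ContinuousLinearMap.opNorm_le_bound _ (Real.sqrt_nonneg _) fun y => ?_
  induction y using UniformSpace.Completion.induction_on with
  | hp => apply isClosed_le <;> fun_prop
  | ih y =>
    rw [gnsRep_coe, UniformSpace.Completion.norm_coe, UniformSpace.Completion.norm_coe]
    exact (leftMul hφ x).le_of_opNorm_le (norm_leftMul_le hφ x) y

end GNS

/-- An even state on the graded algebra `A`. -/
def Grading.IsEvenState (g : Grading A) (ρ : A →ₗ[ℂ] ℂ) : Prop :=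
  IsState ρ ∧ ∀ a, ρ (g.θ a) = ρ a

/-- A functional on the algebraic Fermi tensor product is the product `×_i ρ i` if it maps
`a 0 ⊗ ⋯ ⊗ a (n - 1) ⊗ 1 ⊗ ⋯` to `ρ 0 (a 0) * ⋯ * ρ (n - 1) (a (n - 1))`. -/
def IsProduct (φ : Alg g →ₗ[ℂ] ℂ) (ρ : ℕ → A →ₗ[ℂ] ℂ) : Prop :=
  ∀ (a : ℕ → A) (n : ℕ), φ (elem g a n) = ∏ i ∈ Finset.range n, ρ i (a i)

variable (g) in
/-- The product states of sequences of even states. -/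
def ProductState : Type _ :=
  {φ : Alg g →ₗ[ℂ] ℂ // IsState φ ∧ ∃ ρ : ℕ → A →ₗ[ℂ] ℂ,
    (∀ i, g.IsEvenState (ρ i)) ∧ IsProduct φ ρ}

/-- The minimal (semi)norm of the algebraic Fermi tensor product: the supremum of the norms of `x`
in the GNS representations of all products of even states. -/
def minNorm (x : Alg g) : ℝ := ⨆ ω : ProductState g, ‖gnsRep ω.2.1 x‖

lemma bddAbove_minNorm (x : Alg g) :
    BddAbove (Set.range fun ω : ProductState g => ‖gnsRep ω.2.1 x‖) :=
  ⟨√(exists_bound x).choose, by rintro _ ⟨ω, rfl⟩; exact norm_gnsRep_le ω.2.1 x⟩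

lemma le_minNorm (x : Alg g) (ω : ProductState g) : ‖gnsRep ω.2.1 x‖ ≤ minNorm x :=
  le_ciSup (bddAbove_minNorm x) ω

lemma minNorm_nonneg (x : Alg g) : 0 ≤ minNorm x := Real.iSup_nonneg fun _ => norm_nonneg _

lemma minNorm_add (x y : Alg g) : minNorm (x + y) ≤ minNorm x + minNorm y := by
  refine Real.iSup_le (fun ω => ?_) (add_nonneg (minNorm_nonneg x) (minNorm_nonneg y))
  rw [map_add]
  exact (norm_add_le _ _).trans (add_le_add (le_minNorm x ω) (le_minNorm y ω))

lemma minNorm_mul (x y : Alg g) : minNorm (x * y) ≤ minNorm x * minNorm y := by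
  refine Real.iSup_le (fun ω => ?_) (mul_nonneg (minNorm_nonneg x) (minNorm_nonneg y))
  rw [map_mul]
  exact (norm_mul_le _ _).trans
    (mul_le_mul (le_minNorm x ω) (le_minNorm y ω) (norm_nonneg _) (minNorm_nonneg x))

lemma minNorm_star (x : Alg g) : minNorm (star x) = minNorm x := by
  refine iSup_congr fun ω => ?_
  rw [map_star]
  exact norm_star (gnsRep ω.2.1 x)

lemma minNorm_smul (c : ℂ) (x : Alg g) : minNorm (c • x) = ‖c‖ * minNorm x := by
  simp only [minNorm, map_smul, norm_smul]
  rw [Real.mul_iSup_of_nonneg (norm_nonneg c)]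

lemma minNorm_neg (x : Alg g) : minNorm (-x) = minNorm x := by
  simp only [minNorm, map_neg, norm_neg]

lemma minNorm_zero : minNorm (0 : Alg g) = 0 := by
  simpa using minNorm_smul (0 : ℂ) (0 : Alg g)

lemma minNorm_sq_le (x : Alg g) : minNorm x * minNorm x ≤ minNorm (star x * x) := by
  have h : minNorm x ≤ √(minNorm (star x * x)) := by
    refine Real.iSup_le (fun ω => ?_) (Real.sqrt_nonneg _)
    refine Real.le_sqrt_of_sq_le ?_
    rw [sq, ← CStarRing.norm_star_mul_self, ← map_star, ← map_mul]
    exact le_minNorm _ ω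
  calc minNorm x * minNorm x ≤ √(minNorm (star x * x)) * √(minNorm (star x * x)) :=
        mul_self_le_mul_self (minNorm_nonneg x) h
    _ = _ := Real.mul_self_sqrt (minNorm_nonneg _)

instance : SeminormedAddCommGroup (Alg g) :=
  AddGroupSeminorm.toSeminormedAddCommGroup
    { toFun := minNorm
      map_zero' := minNorm_zero
      add_le' := minNorm_add
      neg' := minNorm_neg }

lemma norm_def (x : Alg g) : ‖x‖ = minNorm x := rfl

instance : SeminormedRing (Alg g) where
  __ := (inferInstance : SeminormedAddCommGroup (Alg g))
  __ := (inferInstance : Ring (Alg g))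
  norm_mul_le := minNorm_mul

instance : NormedAlgebra ℂ (Alg g) where
  norm_smul_le c x := (minNorm_smul c x).le

instance : NormedStarGroup (Alg g) where
  norm_star_le x := (minNorm_star x).le

variable (g) in
/-- The minimal infinite Fermi tensor product of `(A, θ)` with itself: the (Hausdorff) completion of
the algebraic Fermi tensor product in the minimal norm. -/
def MinFermi : Type _ := UniformSpace.Completion (Alg g)

instance : NormedRing (MinFermi g) := inferInstanceAs (NormedRing (UniformSpace.Completion (Alg g)))

instance : NormedSpace ℂ (MinFermi g) :=
  inferInstanceAs (NormedSpace ℂ (UniformSpace.Completion (Alg g)))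

instance : CompleteSpace (MinFermi g) :=
  inferInstanceAs (CompleteSpace (UniformSpace.Completion (Alg g)))

variable (g) in
/-- The canonical map of the algebraic Fermi tensor product into its completion. -/
def toMin (x : Alg g) : MinFermi g := UniformSpace.Completion.coe' x

lemma min_induction {p : MinFermi g → Prop} (x : MinFermi g) (hp : IsClosed {x | p x})
    (h : ∀ x, p (toMin g x)) : p x :=
  UniformSpace.Completion.induction_on x hp h

lemma continuous_toMin : Continuous (toMin g) := UniformSpace.Completion.continuous_coe _

lemma toMin_add (x y : Alg g) : toMin g (x + y) = toMin g x + toMin g y :=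
  UniformSpace.Completion.coe_add x y

lemma toMin_mul (x y : Alg g) : toMin g (x * y) = toMin g x * toMin g y :=
  UniformSpace.Completion.coe_mul x y

lemma toMin_smul (c : ℂ) (x : Alg g) : toMin g (c • x) = c • toMin g x :=
  UniformSpace.Completion.coe_smul c x

lemma toMin_one : toMin g 1 = 1 := rfl

lemma toMin_zero : toMin g 0 = 0 := rfl

lemma norm_toMin (x : Alg g) : ‖toMin g x‖ = ‖x‖ := UniformSpace.Completion.norm_coe x

instance : Star (MinFermi g) :=
  ⟨fun x => (UniformSpace.Completion.map (star : Alg g → Alg g) x : UniformSpace.Completion (Alg g))⟩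

lemma star_toMin (x : Alg g) : star (toMin g x) = toMin g (star x) :=
  UniformSpace.Completion.map_coe star_isometry.uniformContinuous x

lemma continuous_star_min : Continuous (star : MinFermi g → MinFermi g) :=
  UniformSpace.Completion.continuous_map

instance : StarRing (MinFermi g) where
  star_involutive x := by
    induction x using min_induction with
    | hp => exact isClosed_eq (continuous_star_min.comp continuous_star_min) continuous_id
    | h x => rw [star_toMin, star_toMin, star_star]
  star_add x y := by
    induction x using min_induction with
    | hp =>
      exact isClosed_eq (continuous_star_min.comp (continuous_id.add continuous_const))
        (continuous_star_min.add continuous_const)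
    | h x =>
      induction y using min_induction with
      | hp =>
        exact isClosed_eq (continuous_star_min.comp (continuous_const.add continuous_id))
          (continuous_const.add continuous_star_min)
      | h y => rw [← toMin_add, star_toMin, star_toMin, star_toMin, star_add, toMin_add]
  star_mul x y := by
    induction x using min_induction with
    | hp =>
      exact isClosed_eq (continuous_star_min.comp (continuous_id.mul continuous_const))
        (continuous_const.mul continuous_star_min)
    | h x =>
      induction y using min_induction with
      | hp =>
        exact isClosed_eq (continuous_star_min.comp (continuous_const.mul continuous_id))
          (continuous_star_min.mul continuous_const)
      | h y => rw [← toMin_mul, star_toMin, star_toMin, star_toMin, star_mul, toMin_mul]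

instance : CStarRing (MinFermi g) where
  norm_mul_self_le x := by
    induction x using min_induction with
    | hp =>
      exact isClosed_le (continuous_norm.mul continuous_norm)
        (continuous_norm.comp (continuous_star_min.mul continuous_id))
    | h x =>
      rw [star_toMin, ← toMin_mul, norm_toMin, norm_toMin]
      exact minNorm_sq_le x

instance : Algebra ℂ (MinFermi g) :=
  Algebra.ofModule
    (by
      intro r x y
      induction x using min_induction with
      | hp =>
        exact isClosed_eq ((continuous_const_smul r).mul continuous_const)
          ((continuous_id.mul continuous_const).const_smul r)
      | h x =>
        induction y using min_induction with
        | hp =>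
          exact isClosed_eq (continuous_const.mul continuous_id)
            ((continuous_const.mul continuous_id).const_smul r)
        | h y => rw [← toMin_mul, ← toMin_smul, ← toMin_smul, ← toMin_mul, smul_mul_assoc])
    (by
      intro r x y
      induction x using min_induction with
      | hp =>
        exact isClosed_eq (continuous_id.mul continuous_const)
          ((continuous_id.mul continuous_const).const_smul r)
      | h x =>
        induction y using min_induction with
        | hp =>
          exact isClosed_eq (continuous_const.mul (continuous_const_smul r))
            ((continuous_const.mul continuous_id).const_smul r)
        | h y => rw [← toMin_mul, ← toMin_smul, ← toMin_smul, ← toMin_mul, mul_smul_comm])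

instance : NormedAlgebra ℂ (MinFermi g) where
  norm_smul_le c x := (norm_smul c x).le

instance : StarModule ℂ (MinFermi g) where
  star_smul c x := by
    induction x using min_induction with
    | hp =>
      exact isClosed_eq (continuous_star_min.comp (continuous_const_smul c))
        (continuous_star_min.const_smul (star c))
    | h x => rw [← toMin_smul, star_toMin, star_toMin, star_smul, toMin_smul]

instance : CStarAlgebra (MinFermi g) where

variable (g) in
/-- The embedding of `A` into the minimal infinite Fermi tensor product as the `j`-th factor. -/
def factor (j : ℕ) (a : A) : MinFermi g := toMin g (emb g j a)

/-! ### The action of permutations -/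

/-- The exponent of the sign produced by moving homogeneous factors of degrees `s` according to
the permutation `σ`: the number of pairs of odd factors whose order is reversed. -/
def permCross (σ : Equiv.Perm ℕ) (s : Deg) : ZMod 2 :=
  s.sum fun i a => s.sum fun j b => if j < i ∧ σ i < σ j then a * b else 0

/-- The permuted family of degrees. -/
def permDeg (σ : Equiv.Perm ℕ) (s : Deg) : Deg := Finsupp.equivMapDomain σ s

lemma permDeg_apply (σ : Equiv.Perm ℕ) (s : Deg) (i : ℕ) : permDeg σ s i = s (σ.symm i) := rfl

lemma permDeg_add (σ : Equiv.Perm ℕ) (s t : Deg) :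
    permDeg σ (s + t) = permDeg σ s + permDeg σ t := by
  ext i; simp [permDeg_apply]

lemma permDeg_zero (σ : Equiv.Perm ℕ) : permDeg σ 0 = 0 := by
  ext i; simp [permDeg_apply]

lemma permCross_zero (σ : Equiv.Perm ℕ) : permCross σ 0 = 0 := by simp [permCross]

lemma permCross_single (σ : Equiv.Perm ℕ) (j : ℕ) (e : ZMod 2) :
    permCross σ (Finsupp.single j e) = 0 := by
  unfold permCross
  refine (Finsupp.sum_single_index (by simp)).trans ?_
  exact (Finsupp.sum_single_index (by simp)).trans (by simp)

lemma permCross_eq (σ : Equiv.Perm ℕ) (s : Deg) (S : Finset ℕ) (hs : s.support ⊆ S) :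
    permCross σ s = ∑ i ∈ S, ∑ j ∈ S, if j < i ∧ σ i < σ j then s i * s j else 0 := by
  unfold permCross
  rw [Finsupp.sum_of_support_subset s hs _ (by simp)]
  refine Finset.sum_congr rfl fun i _ => ?_
  rw [Finsupp.sum_of_support_subset s hs _ (by simp)]

lemma crossing_permDeg (σ : Equiv.Perm ℕ) (s t : Deg) (S : Finset ℕ) (hs : s.support ⊆ S)
    (ht : t.support ⊆ S) : crossing (permDeg σ s) (permDeg σ t)
      = ∑ i ∈ S, ∑ j ∈ S, if σ j < σ i then s i * t j else 0 := by
  classical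
  have h : ∀ u : Deg, u.support ⊆ S → (permDeg σ u).support ⊆ S.map σ.toEmbedding := by
    intro u hu i hi
    rw [Finsupp.mem_support_iff, permDeg_apply, ← Finsupp.mem_support_iff] at hi
    exact Finset.mem_map.2 ⟨_, hu hi, by simp⟩
  rw [crossing_eq _ _ _ (h s hs) (h t ht), Finset.sum_map]
  refine Finset.sum_congr rfl fun i _ => ?_
  rw [Finset.sum_map]
  refine Finset.sum_congr rfl fun j _ => ?_
  simp [permDeg_apply]

/-- The cocycle identity that makes the signed permutations multiplicative. -/
lemma permCross_add (σ : Equiv.Perm ℕ) (s t : Deg) :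
    crossing s t + permCross σ (s + t)
      = permCross σ s + permCross σ t + crossing (permDeg σ s) (permDeg σ t) := by
  classical
  let S := s.support ∪ t.support
  have hs : s.support ⊆ S := Finset.subset_union_left
  have ht : t.support ⊆ S := Finset.subset_union_right
  have hst : (s + t).support ⊆ S := Finsupp.support_add
  have hexp : permCross σ (s + t) = permCross σ s + permCross σ t
      + ((∑ i ∈ S, ∑ j ∈ S, if j < i ∧ σ i < σ j then s i * t j else 0)
        + ∑ i ∈ S, ∑ j ∈ S, if j < i ∧ σ i < σ j then t i * s j else 0) := by
    rw [permCross_eq σ _ S hst, permCross_eq σ _ S hs, permCross_eq σ _ S ht]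
    simp only [← Finset.sum_add_distrib]
    refine Finset.sum_congr rfl fun i _ => Finset.sum_congr rfl fun j _ => ?_
    split_ifs
    · simp only [Finsupp.add_apply]; ring
    · simp
  have hswap : (∑ i ∈ S, ∑ j ∈ S, if j < i ∧ σ i < σ j then t i * s j else 0)
      = ∑ i ∈ S, ∑ j ∈ S, if i < j ∧ σ j < σ i then s i * t j else 0 := by
    rw [Finset.sum_comm]
    refine Finset.sum_congr rfl fun i _ => Finset.sum_congr rfl fun j _ => ?_
    rw [mul_comm]
  have hmain : crossing s t
      + ((∑ i ∈ S, ∑ j ∈ S, if j < i ∧ σ i < σ j then s i * t j else 0)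
        + ∑ i ∈ S, ∑ j ∈ S, if i < j ∧ σ j < σ i then s i * t j else 0)
      = crossing (permDeg σ s) (permDeg σ t) := by
    rw [crossing_permDeg σ s t S hs ht, crossing_eq s t S hs ht]
    simp only [← Finset.sum_add_distrib]
    refine Finset.sum_congr rfl fun i _ => Finset.sum_congr rfl fun j _ => ?_
    have h2 : s i * t j + s i * t j = 0 := CharTwo.add_self_eq_zero _
    rcases lt_trichotomy i j with h | h | h
    · simp [h, not_lt.2 h.le]
    · subst h; simp
    · rcases lt_or_gt_of_ne (σ.injective.ne h.ne) with h' | h'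
      · simp [h, h'.le.not_gt, h', not_lt.2 h.le]
      · simp [h, h', not_lt.2 h'.le, not_lt.2 h.le, h2]
  rw [hexp, hswap, ← hmain]
  ring

/-- The permutation of the tensor factors of `Tens A`, without signs. -/
def tperm (σ : Equiv.Perm ℕ) : Tens A →ₗ[ℂ] Tens A :=
  (PiTensorProduct.reindex ℂ (fun _ : ℕ => A) σ).toLinearMap

lemma tperm_tprod (σ : Equiv.Perm ℕ) (a : ℕ → A) :
    tperm σ (PiTensorProduct.tprod ℂ a) = PiTensorProduct.tprod ℂ (fun i => a (σ.symm i)) :=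
  PiTensorProduct.reindex_tprod σ a

lemma tperm_mul (σ : Equiv.Perm ℕ) (x y : Tens A) : tperm σ (x * y) = tperm σ x * tperm σ y := by
  induction x using PiTensorProduct.induction_on with
  | add x x' hx hx' => rw [add_mul, map_add, map_add, hx, hx', add_mul]
  | smul_tprod r f =>
    induction y using PiTensorProduct.induction_on with
    | add x x' hx hx' => rw [mul_add, map_add, map_add, hx, hx', mul_add]
    | smul_tprod r' f' =>
      rw [PiTensorProduct.smul_tprod_mul_smul_tprod, map_smul, map_smul, map_smul, tperm_tprod,
        tperm_tprod, tperm_tprod, PiTensorProduct.smul_tprod_mul_smul_tprod]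
      rfl

lemma tperm_mem (g : Grading A) (σ : Equiv.Perm ℕ) {s : Deg} {x : Tens A} (hx : x ∈ comp g s) :
    tperm σ x ∈ comp g (permDeg σ s) := by
  induction hx using Submodule.span_induction with
  | zero => rw [map_zero]; exact zero_mem _
  | add x x' _ _ h h' => rw [map_add]; exact add_mem h h'
  | smul c x _ h => rw [map_smul]; exact Submodule.smul_mem _ _ h
  | mem x hx =>
    obtain ⟨a, ha, ⟨n, hn⟩, rfl⟩ := hx
    rw [tperm_tprod]
    refine Submodule.subset_span ⟨_, fun i => ha _, ⟨(Finset.range n).sup σ + 1, fun i hi => ?_⟩,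
      rfl⟩
    refine hn _ (le_of_not_gt fun h => ?_)
    have := Finset.le_sup (f := σ) (Finset.mem_range.2 h)
    rw [Equiv.apply_symm_apply] at this
    omega

/-- The signed permutation of tensor factors on the component of degree `s`. -/
def permComp (g : Grading A) (σ : Equiv.Perm ℕ) (s : Deg) : comp g s →ₗ[ℂ] Alg g :=
  sgn (permCross σ s) • (incl g (permDeg σ s) ∘ₗ
    LinearMap.codRestrict _ (tperm σ ∘ₗ (comp g s).subtype) (fun x => tperm_mem g σ x.2))

/-- The permutation of tensor factors as a linear map of the algebraic Fermi tensor product. -/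
def permLin (g : Grading A) (σ : Equiv.Perm ℕ) : Alg g →ₗ[ℂ] Alg g :=
  DirectSum.toModule ℂ Deg (Alg g) (permComp g σ)

lemma permLin_incl (σ : Equiv.Perm ℕ) {s : Deg} (x : comp g s) :
    permLin g σ (incl g s x)
      = sgn (permCross σ s) • incl g (permDeg σ s) ⟨tperm σ x.1, tperm_mem g σ x.2⟩ :=
  DirectSum.toModule_lof (R := ℂ) (M := Comp g) s x

lemma permLin_mul (σ : Equiv.Perm ℕ) (x y : Alg g) :
    permLin g σ (x * y) = permLin g σ x * permLin g σ y := by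
  induction x using alg_induction with
  | h0 => simp
  | hadd x x' h h' => rw [add_mul, map_add, map_add, h, h', add_mul]
  | hi s x =>
    induction y using alg_induction with
    | h0 => simp
    | hadd x x' h h' => rw [mul_add, map_add, map_add, h, h', mul_add]
    | hi t y =>
      rw [incl_mul, map_smul, permLin_incl, permLin_incl, permLin_incl, smul_mul_smul_comm,
        incl_mul, smul_smul, smul_smul, ← sgn_add, ← sgn_add, ← sgn_add, permCross_add]
      congr 1
      exact incl_congr g (permDeg_add σ s t) (tperm_mul σ x.1 y.1)

lemma permLin_one (σ : Equiv.Perm ℕ) : permLin g σ 1 = 1 := by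
  rw [← incl_one, permLin_incl, permCross_zero, sgn_zero, one_smul]
  refine incl_congr g (permDeg_zero σ) ?_
  exact tperm_tprod σ 1

/-- The permutation maps the `j`-th tensor factor to the `σ j`-th one. -/
lemma permLin_emb (σ : Equiv.Perm ℕ) (j : ℕ) (a : A) :
    permLin g σ (emb g j a) = emb g (σ j) a := by
  have key : ∀ (e : ZMod 2) (a : A), a ∈ g.part e →
      permLin g σ (emb g j a) = emb g (σ j) a := by
    intro e a ha
    rw [emb_of_mem g j ha, emb_of_mem g (σ j) ha, permLin_incl, permCross_single, sgn_zero,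
      one_smul]
    refine incl_congr g (Finsupp.equivMapDomain_single σ j e) ?_
    change tperm σ ((PiTensorProduct.tprod ℂ) _) = (PiTensorProduct.tprod ℂ) _
    rw [tperm_tprod]
    refine congrArg (PiTensorProduct.tprod ℂ) (funext fun i => ?_)
    by_cases h : i = σ j
    · subst h; simp
    · have h' : σ.symm i ≠ j := fun h' => h (by rw [← h', Equiv.apply_symm_apply])
      simp [h, h']
  rw [← g.proj_add_proj a]
  simp only [map_add]
  simp only [key _ _ (g.proj_mem _ a)]

lemma permLin_star (σ : Equiv.Perm ℕ) (x : Alg g) :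
    permLin g σ (star x) = star (permLin g σ x) := by
  induction x using gen_induction with
  | hadd x y h h' => rw [star_add, map_add, map_add, h, h', star_add]
  | hmul x y h h' => rw [star_mul, permLin_mul, permLin_mul, h, h', star_mul]
  | hsmul c x h => rw [star_smul, map_smul, map_smul, h, star_smul]
  | hemb j a => rw [← map_star (emb g j), permLin_emb, permLin_emb, map_star (emb g (σ j))]

/-- The permutation of tensor factors as a `*`-homomorphism of the algebraic Fermi tensor
product. -/
def permAlg (g : Grading A) (σ : Equiv.Perm ℕ) : Alg g →⋆ₐ[ℂ] Alg g where
  __ := AlgHom.ofLinearMap (permLin g σ) (permLin_one σ) (permLin_mul σ)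
  map_star' := permLin_star σ

lemma permAlg_emb (σ : Equiv.Perm ℕ) (j : ℕ) (a : A) :
    permAlg g σ (emb g j a) = emb g (σ j) a := permLin_emb σ j a

lemma permAlg_incl (σ : Equiv.Perm ℕ) {s : Deg} (x : comp g s) :
    permAlg g σ (incl g s x)
      = sgn (permCross σ s) • incl g (permDeg σ s) ⟨tperm σ x.1, tperm_mem g σ x.2⟩ :=
  permLin_incl σ x

lemma permAlg_mul (σ τ : Equiv.Perm ℕ) (x : Alg g) :
    permAlg g (σ * τ) x = permAlg g σ (permAlg g τ x) := by
  have h : (permAlg g (σ * τ)).toAlgHom = ((permAlg g σ).comp (permAlg g τ)).toAlgHom := by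
    refine algHom_ext' g fun j a => ?_
    change permAlg g (σ * τ) (emb g j a) = permAlg g σ (permAlg g τ (emb g j a))
    rw [permAlg_emb, permAlg_emb, permAlg_emb]
    rfl
  exact DFunLike.congr_fun h x

lemma permAlg_one (x : Alg g) : permAlg g 1 x = x := by
  have h : (permAlg g 1).toAlgHom = AlgHom.id ℂ (Alg g) := by
    refine algHom_ext' g fun j a => ?_
    exact permAlg_emb 1 j a
  exact DFunLike.congr_fun h x

lemma permAlg_inv (σ : Equiv.Perm ℕ) (x : Alg g) : permAlg g σ (permAlg g σ⁻¹ x) = x := by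
  rw [← permAlg_mul, mul_inv_cancel, permAlg_one]

lemma elem_congr {a b : ℕ → A} {n : ℕ} (h : ∀ i, i < n → a i = b i) :
    elem g a n = elem g b n := by
  induction n with
  | zero => rfl
  | succ n ih =>
    rw [elem, elem, ih fun i hi => h i (hi.trans (Nat.lt_succ_self n)), h n (Nat.lt_succ_self n)]

lemma elem_update_add (a : ℕ → A) (k : ℕ) (b c : A) {n : ℕ} (hk : k < n) :
    elem g (Function.update a k (b + c)) n
      = elem g (Function.update a k b) n + elem g (Function.update a k c) n := by
  induction n with
  | zero => omega
  | succ n ih =>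
    rw [elem, elem, elem]
    rcases eq_or_ne k n with rfl | hkn
    · have h : ∀ d, elem g (Function.update a k d) k = elem g a k := fun d =>
        elem_congr fun i hi => by simp [hi.ne]
      simp only [h, Function.update_self, map_add, mul_add]
    · rw [ih (by omega)]
      simp only [Function.update_of_ne hkn.symm, add_mul]

lemma isProduct_of_homogeneous {φ : Alg g →ₗ[ℂ] ℂ} {ρ : ℕ → A →ₗ[ℂ] ℂ}
    (h : ∀ (s : Deg) (a : ℕ → A), (∀ i, a i ∈ g.part (s i)) → ∀ n,
      φ (elem g a n) = ∏ i ∈ Finset.range n, ρ i (a i)) : IsProduct φ ρ := by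
  have key : ∀ (k : ℕ) (s : Deg) (a : ℕ → A), (∀ i, k ≤ i → a i ∈ g.part (s i)) → ∀ n,
      φ (elem g a n) = ∏ i ∈ Finset.range n, ρ i (a i) := by
    intro k
    induction k with
    | zero => exact fun s a ha n => h s a (fun i => ha i (Nat.zero_le i)) n
    | succ k ih =>
      intro s a ha n
      have hupd : ∀ e b, b ∈ g.part e → φ (elem g (Function.update a k b) n)
          = ∏ i ∈ Finset.range n, ρ i (Function.update a k b i) := by
        intro e b hb
        refine ih (s.update k e) _ (fun i hi => ?_) n
        rcases eq_or_ne i k with rfl | hik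
        · simpa using hb
        · simpa [hik] using ha i (by omega)
      by_cases hk : k < n
      · have hprod : ∀ b, ∏ i ∈ Finset.range n, ρ i (Function.update a k b i)
            = ρ k b * ∏ i ∈ Finset.range n \ {k}, ρ i (a i) := by
          intro b
          rw [← Finset.prod_update_of_mem (Finset.mem_range.2 hk)]
          refine Finset.prod_congr rfl fun i _ => ?_
          rcases eq_or_ne i k with rfl | hik
          · simp
          · simp [hik]
        have ha' : a = Function.update a k (g.proj 0 (a k) + g.proj 1 (a k)) := by
          rw [g.proj_add_proj, Function.update_eq_self]
        rw [ha', elem_update_add _ _ _ _ hk, map_add, hupd _ _ (g.proj_mem 0 _),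
          hupd _ _ (g.proj_mem 1 _), hprod, hprod, hprod, map_add, add_mul]
      · have h0 := hupd 0 0 (zero_mem _)
        rw [elem_congr (b := a) fun i hi => by simp [show i ≠ k by omega]] at h0
        rw [h0]
        refine Finset.prod_congr rfl fun i hi => ?_
        have := Finset.mem_range.1 hi
        simp [show i ≠ k by omega]
  intro a n
  have h0 := key n 0 (fun i => if i < n then a i else 0)
    (fun i hi => by simp [not_lt.2 hi]) n
  rw [elem_congr (b := a) fun i hi => by simp [hi]] at h0
  rw [h0]
  refine Finset.prod_congr rfl fun i hi => ?_
  simp [Finset.mem_range.1 hi]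

lemma Grading.IsEvenState.apply_odd {ρ : A →ₗ[ℂ] ℂ} (h : g.IsEvenState ρ) {a : A}
    (ha : a ∈ g.part 1) : ρ a = 0 := by
  have h1 := h.2 a
  rw [g.mem_part.1 ha, map_smul, sgn_one, smul_eq_mul] at h1
  linear_combination (-1 / 2 : ℂ) * h1

lemma IsState.comp_permAlg {φ : Alg g →ₗ[ℂ] ℂ} (hφ : IsState φ) (σ : Equiv.Perm ℕ) :
    IsState (φ ∘ₗ permLin g σ) where
  nonneg x := by
    rw [LinearMap.comp_apply, permLin_mul, permLin_star]
    exact hφ.nonneg _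
  map_one := by
    rw [LinearMap.comp_apply, permLin_one]
    exact hφ.map_one

/-- Permuting the tensor factors turns products of even states into such products. -/
lemma IsProduct.comp_perm {φ : Alg g →ₗ[ℂ] ℂ} {ρ : ℕ → A →ₗ[ℂ] ℂ}
    (hρ : ∀ i, g.IsEvenState (ρ i)) (h : IsProduct φ ρ) (σ : Equiv.Perm ℕ) :
    IsProduct (φ ∘ₗ permLin g σ) (fun i => ρ (σ i)) := by
  refine isProduct_of_homogeneous fun s a ha n => ?_
  let a' : ℕ → A := fun i => if σ.symm i < n then a (σ.symm i) else 1
  let m : ℕ := (Finset.range n).sup σ + 1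
  have hm : ∀ i, i < n → σ i < m := by
    intro i hi
    have := Finset.le_sup (f := σ) (Finset.mem_range.2 hi)
    omega
  have ha' : ∀ i, a' i ∈ g.part (permDeg σ (trunc s n) i) := by
    intro i
    rw [permDeg_apply, trunc_apply]
    simp only [a']
    split_ifs
    · exact ha _
    · exact g.one_mem
  have hperm : permLin g σ (elem g a n) = sgn (permCross σ (trunc s n)) • elem g a' m := by
    rw [elem_eq g ha, permLin_incl, elem_eq g ha']
    refine congrArg _ (incl_congr g ?_ ?_)
    · ext i
      rw [trunc_apply, permDeg_apply, trunc_apply]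
      by_cases h1 : σ.symm i < n
      · have := hm _ h1
        rw [Equiv.apply_symm_apply] at this
        simp [h1, this]
      · simp [h1]
    · change tperm σ ((PiTensorProduct.tprod ℂ) _) = (PiTensorProduct.tprod ℂ) _
      rw [tperm_tprod]
      refine congrArg (PiTensorProduct.tprod ℂ) (funext fun i => ?_)
      simp only [a']
      by_cases h1 : σ.symm i < n
      · have := hm _ h1
        rw [Equiv.apply_symm_apply] at this
        simp [h1, this]
      · simp [h1]
  have hprod : ∏ i ∈ Finset.range m, ρ i (a' i) = ∏ i ∈ Finset.range n, ρ (σ i) (a i) := by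
    have h1 : ∏ i ∈ (Finset.range n).map σ.toEmbedding, ρ i (a' i)
        = ∏ i ∈ Finset.range n, ρ (σ i) (a i) := by
      rw [Finset.prod_map]
      refine Finset.prod_congr rfl fun i hi => ?_
      simp [a', Finset.mem_range.1 hi]
    rw [← h1]
    symm
    refine Finset.prod_subset ?_ ?_
    · intro i hi
      obtain ⟨j, hj, rfl⟩ := Finset.mem_map.1 hi
      exact Finset.mem_range.2 (hm j (Finset.mem_range.1 hj))
    · intro i _ hi
      have h2 : ¬ σ.symm i < n := fun h2 =>
        hi (Finset.mem_map.2 ⟨σ.symm i, Finset.mem_range.2 h2, by simp⟩)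
      simp only [a', h2, if_false]
      exact (hρ i).1.map_one
  rw [LinearMap.comp_apply, hperm, map_smul, h, hprod]
  by_cases h0 : ∃ i, i < n ∧ s i = 1
  · obtain ⟨i, hi, hsi⟩ := h0
    have hz : ∏ i ∈ Finset.range n, ρ (σ i) (a i) = 0 := by
      refine Finset.prod_eq_zero (Finset.mem_range.2 hi) ((hρ (σ i)).apply_odd ?_)
      rw [← hsi]
      exact ha i
    rw [hz, smul_zero]
  · have hs : trunc s n = 0 := by
      ext i
      rw [trunc_apply, Finsupp.zero_apply]
      split_ifs with hi
      · rcases deg_cases (s i) with h1 | h1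
        · exact h1
        · exact absurd ⟨i, hi, h1⟩ h0
      · rfl
    rw [hs, permCross_zero, sgn_zero, one_smul]

/-- The permuted product state. -/
def ProductState.perm (σ : Equiv.Perm ℕ) (ω : ProductState g) : ProductState g :=
  ⟨ω.1 ∘ₗ permLin g σ, ω.2.1.comp_permAlg σ, by
    obtain ⟨ρ, hρ, h⟩ := ω.2.2
    exact ⟨fun i => ρ (σ i), fun i => hρ _, h.comp_perm hρ σ⟩⟩

lemma minNorm_perm_le (σ : Equiv.Perm ℕ) (x : Alg g) : minNorm (permAlg g σ x) ≤ minNorm x := by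
  refine Real.iSup_le (fun ω => ?_) (minNorm_nonneg x)
  refine le_trans ?_ (le_minNorm x (ω.perm σ))
  refine ContinuousLinearMap.opNorm_le_bound _ (norm_nonneg _) fun y => ?_
  induction y using UniformSpace.Completion.induction_on with
  | hp => apply isClosed_le <;> fun_prop
  | ih y =>
    obtain ⟨z, rfl⟩ : ∃ z, y = toPreGNS ω.2.1 (permAlg g σ z) :=
      ⟨permAlg g σ⁻¹ ((toPreGNS ω.2.1).symm y), by rw [permAlg_inv, LinearEquiv.apply_symm_apply]⟩
    have key : ∀ w : Alg g, ‖toPreGNS ω.2.1 (permAlg g σ w)‖ = ‖toPreGNS (ω.perm σ).2.1 w‖ := by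
      intro w
      rw [← sq_eq_sq₀ (norm_nonneg _) (norm_nonneg _), preGNS_norm_sq, preGNS_norm_sq,
        LinearEquiv.symm_apply_apply, LinearEquiv.symm_apply_apply, ← map_star, ← map_mul]
      rfl
    rw [gnsRep_coe, leftMul_apply, LinearEquiv.symm_apply_apply, ← map_mul,
      UniformSpace.Completion.norm_coe, UniformSpace.Completion.norm_coe, key, key]
    have h := (gnsRep (ω.perm σ).2.1 x).le_opNorm (toPreGNS (ω.perm σ).2.1 z : PreGNS _)
    rwa [gnsRep_coe, leftMul_apply, LinearEquiv.symm_apply_apply, UniformSpace.Completion.norm_coe,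
      UniformSpace.Completion.norm_coe] at h

lemma uniformContinuous_permAlg (σ : Equiv.Perm ℕ) : UniformContinuous (permAlg g σ) := by
  refine LipschitzWith.uniformContinuous (K := 1) (LipschitzWith.of_dist_le_mul fun x y => ?_)
  rw [NNReal.coe_one, one_mul, dist_eq_norm, dist_eq_norm, ← map_sub]
  exact minNorm_perm_le σ _

/-- The extension to the completion of the permutation of tensor factors. -/
def permFun (g : Grading A) (σ : Equiv.Perm ℕ) (x : MinFermi g) : MinFermi g :=
  UniformSpace.Completion.map (permAlg g σ) x

lemma permFun_toMin (σ : Equiv.Perm ℕ) (x : Alg g) :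
    permFun g σ (toMin g x) = toMin g (permAlg g σ x) :=
  UniformSpace.Completion.map_coe (uniformContinuous_permAlg σ) x

lemma continuous_permFun (σ : Equiv.Perm ℕ) : Continuous (permFun g σ) :=
  UniformSpace.Completion.continuous_map

lemma permFun_mul_perm (σ τ : Equiv.Perm ℕ) (x : MinFermi g) :
    permFun g (σ * τ) x = permFun g σ (permFun g τ x) := by
  induction x using min_induction with
  | hp => exact isClosed_eq (continuous_permFun _) ((continuous_permFun _).comp (continuous_permFun _))
  | h x => rw [permFun_toMin, permFun_toMin, permFun_toMin, permAlg_mul]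

lemma permFun_one (x : MinFermi g) : permFun g 1 x = x := by
  induction x using min_induction with
  | hp => exact isClosed_eq (continuous_permFun _) continuous_id
  | h x => rw [permFun_toMin, permAlg_one]

/-- The permutation of tensor factors as a `*`-automorphism of the minimal infinite Fermi tensor
product. -/
def permAut (g : Grading A) (σ : Equiv.Perm ℕ) : MinFermi g ≃⋆ₐ[ℂ] MinFermi g where
  toFun := permFun g σ
  invFun := permFun g σ⁻¹
  left_inv x := by rw [← permFun_mul_perm, inv_mul_cancel, permFun_one]
  right_inv x := by rw [← permFun_mul_perm, mul_inv_cancel, permFun_one]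
  map_add' x y := by
    induction x, y using UniformSpace.Completion.induction_on₂ with
    | hp =>
      exact isClosed_eq ((continuous_permFun σ).comp (continuous_fst.add continuous_snd))
        (((continuous_permFun σ).comp continuous_fst).add ((continuous_permFun σ).comp continuous_snd))
    | ih x y =>
      change permFun g σ (toMin g x + toMin g y)
        = permFun g σ (toMin g x) + permFun g σ (toMin g y)
      rw [← toMin_add, permFun_toMin, permFun_toMin, permFun_toMin, map_add, toMin_add]
  map_mul' x y := by
    induction x, y using UniformSpace.Completion.induction_on₂ with
    | hp =>
      exact isClosed_eq ((continuous_permFun σ).comp (continuous_fst.mul continuous_snd))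
        (((continuous_permFun σ).comp continuous_fst).mul ((continuous_permFun σ).comp continuous_snd))
    | ih x y =>
      change permFun g σ (toMin g x * toMin g y)
        = permFun g σ (toMin g x) * permFun g σ (toMin g y)
      rw [← toMin_mul, permFun_toMin, permFun_toMin, permFun_toMin, map_mul, toMin_mul]
  map_star' x := by
    induction x using min_induction with
    | hp =>
      exact isClosed_eq ((continuous_permFun σ).comp continuous_star_min)
        (continuous_star_min.comp (continuous_permFun σ))
    | h x => rw [star_toMin, permFun_toMin, permFun_toMin, star_toMin, map_star]
  map_smul' c x := by
    induction x using min_induction with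
    | hp =>
      exact isClosed_eq ((continuous_permFun σ).comp (continuous_const_smul c))
        ((continuous_permFun σ).const_smul c)
    | h x => rw [← toMin_smul, permFun_toMin, permFun_toMin, map_smul, toMin_smul]

/-- The group of finite permutations of `ℕ`. -/
def finPerm : Subgroup (Equiv.Perm ℕ) where
  carrier := {σ | {i | σ i ≠ i}.Finite}
  mul_mem' := by
    intro σ τ hσ hτ
    refine (Set.Finite.union hσ hτ).subset fun i hi => ?_
    by_contra h
    simp only [Set.mem_union, Set.mem_ofPred_eq, not_or, not_not] at h
    exact hi (by rw [Equiv.Perm.mul_apply, h.2, h.1])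
  one_mem' := by simp
  inv_mem' := by
    intro σ hσ
    refine Set.Finite.subset hσ fun i hi h => hi ?_
    exact Equiv.Perm.inv_eq_iff_eq.2 h.symm

/-- The natural action of the finite permutations on the minimal infinite Fermi tensor product. -/
def permAction (g : Grading A) : finPerm →* (MinFermi g ≃⋆ₐ[ℂ] MinFermi g) where
  toFun σ := permAut g σ
  map_one' := by
    ext x
    exact permFun_one x
  map_mul' σ τ := by
    ext x
    exact permFun_mul_perm (σ : Equiv.Perm ℕ) τ x

/-- The action is the natural one: it maps the `j`-th tensor factor to the `σ j`-th one. -/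
lemma permAction_factor (g : Grading A) (σ : finPerm) (j : ℕ) (a : A) :
    permAction g σ (factor g j a) = factor g ((σ : Equiv.Perm ℕ) j) a := by
  change permFun g σ (toMin g (emb g j a)) = toMin g (emb g _ a)
  rw [permFun_toMin, permAlg_emb]

/-! ### Symmetric states -/

variable (g) in
/-- The convex set of symmetric states, that is, of states invariant under the permutations. -/
def symmetricStates : Set (MinFermi g →ₗ[ℂ] ℂ) :=
  {ω | IsState ω ∧ ∀ (σ : finPerm) (x : MinFermi g), ω (permAction g σ x) = ω x}

/-- The map that exchanges the blocks `{0, …, 2 ^ n - 1}` and `{2 ^ n, …, 2 ^ (n + 1) - 1}`. -/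
def blockSwapFun (n k : ℕ) : ℕ :=
  if k < 2 ^ n then k + 2 ^ n else if k < 2 ^ (n + 1) then k - 2 ^ n else k

lemma blockSwapFun_invol (n k : ℕ) : blockSwapFun n (blockSwapFun n k) = k := by
  have h : 2 ^ (n + 1) = 2 ^ n + 2 ^ n := by ring
  have hp : 0 < 2 ^ n := by positivity
  unfold blockSwapFun
  rw [h]
  generalize 2 ^ n = m at *
  split_ifs <;> omega

/-- The finite permutation that exchanges the blocks `{0, …, 2 ^ n - 1}` and
`{2 ^ n, …, 2 ^ (n + 1) - 1}` by translation and fixes all other points. -/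
def blockSwap (n : ℕ) : finPerm :=
  ⟨⟨blockSwapFun n, blockSwapFun n, blockSwapFun_invol n, blockSwapFun_invol n⟩, by
    refine (Set.finite_lt_nat (2 ^ (n + 1))).subset fun k hk => ?_
    by_contra h
    have h1 : ¬ k < 2 ^ (n + 1) := h
    have h2 : ¬ k < 2 ^ n := fun h2 => h1 (h2.trans (Nat.pow_lt_pow_right one_lt_two n.lt_succ_self))
    refine hk ?_
    change blockSwapFun n k = k
    simp [blockSwapFun, h1, h2]⟩

/-- A state is strongly clustering (mixing) if `ω (α_{σ_n} a * b) → ω a * ω b` for all `a`, `b`,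
where `σ_n` are the block exchanges. -/
def IsStronglyClustering (ω : MinFermi g →ₗ[ℂ] ℂ) : Prop :=
  ∀ a b : MinFermi g, Filter.Tendsto (fun n => ω (permAction g (blockSwap n) a * b)) Filter.atTop
    (nhds (ω a * ω b))

/-- `ω` is the infinite product `×_i ρ i`, that is, `ω` maps
`a 0 ⊗ ⋯ ⊗ a (n - 1) ⊗ 1 ⊗ 1 ⊗ ⋯` to `ρ 0 (a 0) * ⋯ * ρ (n - 1) (a (n - 1))`. -/
def IsInfiniteProduct (ω : MinFermi g →ₗ[ℂ] ℂ) (ρ : ℕ → A →ₗ[ℂ] ℂ) : Prop :=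
  ∀ (a : ℕ → A) (n : ℕ), ω (toMin g (elem g a n)) = ∏ i ∈ Finset.range n, ρ i (a i)

end Fermi
end

/-! Condition 3 is the hub: the implications proved are 1 → 3, 2 → 3, 3 → 1 and 3 → 2. In both
implications into 3 the even state is the restriction `oneSite ω` of `ω` to one tensor factor.

Evenness comes from anticommutation. Copies `ι_k x` of an odd self-adjoint `x` anticommute, so a sum
of `N` of them squares to a sum of `N` squares and has norm of order `√N`. By symmetry `ω (e * ι_k
x)` is the same number for all `k` beyond the support of an elementary tensor `e`, and the sum over
`N` such sites gives `N` times this number. Hence it vanishes (`apply_elem_mul_odd`).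

For 2 → 3, the invariance of `ω` turns `ω (α_{σ_k} e * ι_n x)` into `ω (e * ι_n x)` for all large
`k`, and clustering then splits off the last factor. An induction over the ordered product gives the
product formula (`isInfiniteProduct_oneSite`).

For 1 → 3, an even `x` in a remote factor commutes asymptotically with everything. If moreover `0 ≤
x`, then `b ↦ lim_k ω (ι_k x * b)` is positive, symmetric and, up to normalization, a state. For `x
= (1 ± h) / 2` the two functionals add up to `ω`, so extremality makes each a multiple of `ω`; this
is the factorization for even elements. On odd elements both sides vanish.

For 3 → 2, the two factors of `α_{σ_n} a * b` occupy disjoint blocks when `a` and `b` are local and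
`n` is large, so a product state factorizes exactly; uniform bounds extend the limit to the
completion.

For 3 → 1, let `t ω₁ ≤ ω` with `ω₁` a symmetric state and `0 < t`. Centred remote copies `y_k =
α_{σ_k} a - ω a` are orthogonal in the GNS space of `ω`, so `ω (S* S)` grows at most like `N` for
`S` a sum of `N` of them, whereas `|ω₁ S|² = N² |ω₁ a - ω a|²`. Hence `ω₁ a = ω a`. This is a weak
law of large numbers. -/

noncomputable section

namespace Fermi

open Filter Topology

/-! ### Positive functionals -/

section States

variable {D : Type*}

/-- The Schwarz inequality `|φ x|² ≤ φ (x* x)` for states. -/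
lemma IsState.norm_sq_le [Ring D] [StarRing D] [Algebra ℂ D] [StarModule ℂ D]
    {φ : D →ₗ[ℂ] ℂ} (h : IsState φ) (x : D) : ‖φ x‖ ^ 2 ≤ (φ (star x * x)).re := by
  -- The variance of `x` in the state `φ` is nonnegative.
  have h1 := (Complex.le_def.1 (h.nonneg (x - φ x • 1))).1
  have h2 : star (x - φ x • (1 : D)) * (x - φ x • 1)
      = star x * x - φ x • star x - starRingEnd ℂ (φ x) • x
        + (starRingEnd ℂ (φ x) * φ x) • (1 : D) := by
    rw [star_sub, star_smul, star_one, sub_mul, mul_sub, mul_sub, mul_smul_comm, mul_one,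
      smul_mul_assoc, one_mul, smul_mul_smul_comm, mul_one]
    simp only [Complex.star_def]
    abel
  rw [h2, map_add, map_sub, map_sub, map_smul, map_smul, map_smul, h.map_one, h.map_star] at h1
  simp only [smul_eq_mul, mul_one, Complex.mul_conj, Complex.conj_mul', Complex.add_re,
    Complex.sub_re, Complex.zero_re, Complex.normSq_eq_norm_sq] at h1
  norm_cast at h1
  linarith

/-- States of a C*-algebra are contractive. -/
lemma IsState.norm_apply_le [CStarAlgebra D] {φ : D →ₗ[ℂ] ℂ} (h : IsState φ) (x : D) :
    ‖φ x‖ ≤ ‖x‖ := by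
  let _ := CStarAlgebra.spectralOrder D
  let _ := CStarAlgebra.spectralOrderedRing D
  -- Positivity applied to `‖x* x‖ - x* x = z* z` gives `φ (x* x) ≤ ‖x‖²`; the Schwarz inequality
  -- then bounds `φ x` itself.
  have h1 : star x * x ≤ algebraMap ℝ D ‖star x * x‖ :=
    IsSelfAdjoint.le_algebraMap_norm_self (IsSelfAdjoint.star_mul_self x)
  obtain ⟨z, hz⟩ := CStarAlgebra.nonneg_iff_eq_star_mul_self.1 (sub_nonneg.2 h1)
  have h2 := (Complex.le_def.1 (h.nonneg z)).1
  have h3 : algebraMap ℝ D ‖star x * x‖ = ((‖star x * x‖ : ℝ) : ℂ) • (1 : D) := by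
    rw [Algebra.algebraMap_eq_smul_one]; simp
  rw [← hz, map_sub, h3, map_smul, h.map_one, CStarRing.norm_star_mul_self] at h2
  simp only [smul_eq_mul, mul_one, Complex.sub_re, Complex.ofReal_re, Complex.zero_re] at h2
  have h4 := h.norm_sq_le x
  exact abs_le_of_sq_le_sq' (by nlinarith) (norm_nonneg x) |>.2

lemma IsState.continuous [CStarAlgebra D] {φ : D →ₗ[ℂ] ℂ} (h : IsState φ) : Continuous φ :=
  AddMonoidHomClass.continuous_of_bound φ 1 fun x => by simpa using h.norm_apply_le x

/-- If `h` is a self-adjoint contraction, then `(1 + h) / 2` is of the form `y* y`. -/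
lemma exists_star_mul_self_eq [CStarAlgebra D] {h : D} (hsa : IsSelfAdjoint h) (hn : ‖h‖ ≤ 1) :
    ∃ y, (2⁻¹ : ℂ) • (1 + h) = star y * y := by
  let _ := CStarAlgebra.spectralOrder D
  let _ := CStarAlgebra.spectralOrderedRing D
  -- Adding `‖h‖ ≤ 1` and `-‖h‖ ≤ h` gives `0 ≤ 1 + h`.
  have h1 : -algebraMap ℝ D ‖h‖ ≤ h := IsSelfAdjoint.neg_algebraMap_norm_le_self hsa
  have h2 : algebraMap ℝ D ‖h‖ ≤ 1 := by
    rw [← map_one (algebraMap ℝ D)]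
    exact algebraMap_mono D hn
  have h3 : (0 : D) ≤ 1 + h := by
    have := add_le_add h2 h1
    rwa [add_neg_cancel] at this
  obtain ⟨z, hz⟩ := CStarAlgebra.nonneg_iff_eq_star_mul_self.1 h3
  -- Here `1 + h = z* z`; the factor `1 / √2` accounts for the `1 / 2`.
  refine ⟨((√2)⁻¹ : ℝ) • z, ?_⟩
  rw [hz, star_smul, smul_mul_smul_comm, star_trivial (√2)⁻¹, ← mul_inv,
    Real.mul_self_sqrt zero_le_two, ← Complex.coe_smul]
  norm_num

end States

/-! ### Limits of uniformly Lipschitz sequences -/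

/-- The points of convergence of a uniformly Lipschitz sequence of functions form a closed set. -/
lemma isClosed_setOf_tendsto_of_lipschitz {E : Type*} [SeminormedAddCommGroup E] {f : ℕ → E → ℂ}
    {f₀ : E → ℂ} {C : ℝ} (hf : ∀ n x y, ‖f n x - f n y‖ ≤ C * ‖x - y‖)
    (hf₀ : Continuous f₀) :
    IsClosed {x | Tendsto (fun n => f n x) atTop (𝓝 (f₀ x))} := by
  refine UniformEquicontinuous.equicontinuous ?_ |>.isClosed_setOfPred_tendsto hf₀
  refine LipschitzWith.uniformEquicontinuous f C.toNNReal fun n => ?_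
  refine LipschitzWith.of_dist_le_mul fun x y => ?_
  rw [dist_eq_norm, dist_eq_norm]
  exact (hf n x y).trans (mul_le_mul_of_nonneg_right (Real.le_coe_toNNReal C) (norm_nonneg _))

variable {A : Type*} [CStarAlgebra A] {g : Grading A}

/-! ### Local elements -/

variable (g) in
/-- The canonical map of the algebraic Fermi tensor product into its completion, as a
`*`-homomorphism. -/
def toMinHom : Alg g →⋆ₐ[ℂ] MinFermi g where
  toFun := toMin g
  map_one' := toMin_one
  map_mul' := toMin_mul
  map_zero' := toMin_zero
  map_add' := toMin_add
  commutes' r := by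
    rw [Algebra.algebraMap_eq_smul_one, toMin_smul, toMin_one, ← Algebra.algebraMap_eq_smul_one]
  map_star' x := (star_toMin x).symm

variable (g) in
/-- The embedding of `A` as the `j`-th tensor factor, as a `*`-homomorphism. -/
def factorHom (j : ℕ) : A →⋆ₐ[ℂ] MinFermi g := (toMinHom g).comp (emb g j)

lemma factorHom_apply (j : ℕ) (a : A) : factorHom g j a = toMinHom g (emb g j a) := rfl

lemma norm_factorHom_le (j : ℕ) (a : A) : ‖factorHom g j a‖ ≤ ‖a‖ :=
  NonUnitalStarAlgHom.norm_apply_le (factorHom g j) a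

/-- The density principle phrased for the bundled homomorphism, so that the general `map_*` lemmas
apply to its values. -/
lemma toMinHom_induction {p : MinFermi g → Prop} (x : MinFermi g) (hp : IsClosed {x | p x})
    (h : ∀ x, p (toMinHom g x)) : p x := min_induction x hp h

lemma permAction_toMinHom (σ : finPerm) (x : Alg g) :
    permAction g σ (toMinHom g x) = toMinHom g (permAlg g σ x) :=
  permFun_toMin (σ : Equiv.Perm ℕ) x

lemma permAction_factorHom (σ : finPerm) (j : ℕ) (a : A) :
    permAction g σ (factorHom g j a) = factorHom g ((σ : Equiv.Perm ℕ) j) a :=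
  permAction_factor g σ j a

/-- The elementary tensors span the algebraic Fermi tensor product. -/
lemma elem_induction {p : Alg g → Prop} (hadd : ∀ x y, p x → p y → p (x + y))
    (hsmul : ∀ (c : ℂ) x, p x → p (c • x)) (helem : ∀ a n, p (elem g a n)) (x : Alg g) : p x := by
  have h0 : p 0 := by simpa using hsmul 0 _ (helem 1 0)
  induction x using alg_induction with
  | h0 => exact h0
  | hadd x x' h h' => exact hadd _ _ h h'
  | hi s x =>
    obtain ⟨x, hx⟩ := x
    induction hx using Submodule.span_induction with
    | zero =>
      convert h0
      exact map_zero (incl g s)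
    | add x y hx hy h h' =>
      convert hadd _ _ h h'
      exact map_add (incl g s) ⟨x, hx⟩ ⟨y, hy⟩
    | smul c x hx h =>
      convert hsmul c _ h
      exact map_smul (incl g s) c ⟨x, hx⟩
    | mem x hx =>
      obtain ⟨a, ha, ⟨n, hn⟩, rfl⟩ := hx
      obtain ⟨m, hm⟩ : ∃ m, ∀ i, m ≤ i → s i = 0 := by
        refine ⟨s.support.sup id + 1, fun i hi => ?_⟩
        by_contra h
        have := Finset.le_sup (f := id) (Finsupp.mem_support_iff.2 h)
        simp only [id] at this
        omega
      -- The cutoff has to pass both the last factor different from `1` and the support of `s`: the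
      -- component is indexed by the degree family, so truncation must leave that unchanged as well.
      convert helem a (max n m)
      rw [elem_eq g ha]
      refine incl_congr g ?_ ?_
      · ext i
        rw [trunc_apply]
        split_ifs with h
        · rfl
        · exact hm i (by omega)
      · change (PiTensorProduct.tprod ℂ) _ = (PiTensorProduct.tprod ℂ) _
        refine congrArg _ (funext fun i => ?_)
        split_ifs with h
        · rfl
        · exact hn i (by omega)

/-- Homogeneous elements of different factors commute up to a sign. -/
lemma emb_mul_emb_comm {d e : ZMod 2} {x y : A} (hx : x ∈ g.part d) (hy : y ∈ g.part e)
    {j k : ℕ} (hjk : j ≠ k) :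
    emb g j x * emb g k y = sgn (d * e) • (emb g k y * emb g j x) := by
  have hcr : ∀ (i l : ℕ) (c f : ZMod 2), crossing (Finsupp.single i c) (Finsupp.single l f)
      = if l < i then c * f else 0 := by
    intro i l c f
    unfold crossing
    rw [Finsupp.sum_single_index (by simp), Finsupp.sum_single_index (by simp)]
  rw [emb_of_mem g j hx, emb_of_mem g k hy, incl_mul, incl_mul, smul_smul, hcr, hcr, ← sgn_add]
  congr 1
  · congr 1
    -- For `j < k` only the product on the right carries a crossing sign, and it cancels the
    -- prefactor modulo two; for `k < j` the sign comes from the product on the left.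
    have h2 : d * e + e * d = 0 := by rw [mul_comm e d]; exact CharTwo.add_self_eq_zero _
    rcases lt_or_gt_of_ne hjk with h | h
    · simp [h, h.not_gt, h2]
    · simp [h, h.not_gt]
  · refine incl_congr g (add_comm _ _) ?_
    change (PiTensorProduct.tprod ℂ) _ * (PiTensorProduct.tprod ℂ) _
      = (PiTensorProduct.tprod ℂ) _ * (PiTensorProduct.tprod ℂ) _
    rw [PiTensorProduct.tprod_mul_tprod, PiTensorProduct.tprod_mul_tprod]
    refine congrArg (PiTensorProduct.tprod ℂ) (funext fun i => ?_)
    rw [Pi.mul_apply, Pi.mul_apply]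
    rcases eq_or_ne i j with rfl | hij
    · simp [hjk]
    · simp [hij]

/-- Even elements of remote factors commute with local elements. -/
lemma eventually_commute_emb {x : A} (hx : x ∈ g.part 0) (b : Alg g) :
    ∀ᶠ k in atTop, Commute (emb g k x) b := by
  induction b using gen_induction with
  | hadd b c hb hc => filter_upwards [hb, hc] with k h h' using h.add_right h'
  | hmul b c hb hc => filter_upwards [hb, hc] with k h h' using h.mul_right h'
  | hsmul c b hb => filter_upwards [hb] with k h using h.smul_right c
  | hemb j a =>
    filter_upwards [eventually_gt_atTop j] with k hk
    rw [← g.proj_add_proj a, map_add]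
    -- The exponent of the commutation sign is a product with degree `0`, so nothing is picked up
    -- from either homogeneous part of `a`.
    have key : ∀ e, Commute (emb g k x) (emb g j (g.proj e a)) := fun e => by
      have := emb_mul_emb_comm hx (g.proj_mem e a) hk.ne'
      rwa [zero_mul, sgn_zero, one_smul] at this
    exact (key 0).add_right (key 1)

lemma permAlg_elem_of_forall {σ : Equiv.Perm ℕ} {n : ℕ} (hσ : ∀ i, i < n → σ i = i) (a : ℕ → A) :
    permAlg g σ (elem g a n) = elem g a n := by
  induction n with
  | zero => exact map_one _
  | succ n ih =>
    rw [elem, map_mul, ih fun i hi => hσ i (hi.trans n.lt_succ_self), permAlg_emb,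
      hσ n n.lt_succ_self]

lemma blockSwap_apply_of_lt {n k : ℕ} (h : k < 2 ^ n) :
    (blockSwap n : Equiv.Perm ℕ) k = k + 2 ^ n := by
  change blockSwapFun n k = _
  simp [blockSwapFun, h]

lemma blockSwap_apply_of_le {n k : ℕ} (h : 2 ^ (n + 1) ≤ k) :
    (blockSwap n : Equiv.Perm ℕ) k = k := by
  change blockSwapFun n k = _
  have h2 : 2 ^ (n + 1) = 2 ^ n + 2 ^ n := by ring
  simp only [blockSwapFun]
  rw [if_neg (by omega), if_neg (by omega)]

/-- Together with invariance this moves the exchange from one argument to the other: `ω (α a * b) =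
ω (a * α b)`. -/
lemma permAction_blockSwap_blockSwap (n : ℕ) (x : MinFermi g) :
    permAction g (blockSwap n) (permAction g (blockSwap n) x) = x := by
  have h : blockSwap n * blockSwap n = 1 := by
    ext k
    exact blockSwapFun_invol n k
  have h2 := congrArg (fun e : MinFermi g ≃⋆ₐ[ℂ] MinFermi g => e x)
    ((map_mul (permAction g) (blockSwap n) (blockSwap n)).symm.trans (by rw [h, map_one]))
  exact h2

/-- A product of an elementary tensor with a shifted elementary tensor is an elementary tensor. -/
lemma elem_mul_permAlg_elem (u v : ℕ → A) (N k : ℕ) (hu : ∀ i, N ≤ i → u i = 1) {n : ℕ}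
    (hn : n ≤ 2 ^ k) (hN : N ≤ 2 ^ k) :
    elem g u N * permAlg g (blockSwap k : Equiv.Perm ℕ) (elem g v n)
      = elem g (fun i => if i < 2 ^ k then u i else v (i - 2 ^ k)) (2 ^ k + n) := by
  induction n with
  | zero =>
    rw [elem, map_one, mul_one, add_zero]
    -- Padding `u` with units up to the end of the first block does not change the element.
    have h1 : ∀ M, elem g u (N + M) = elem g u N := by
      intro M
      induction M with
      | zero => rfl
      | succ M ih => rw [← add_assoc, elem, ih, hu _ (by omega), map_one, mul_one]
    obtain ⟨M, hM⟩ := Nat.exists_eq_add_of_le hN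
    rw [← h1 M, ← hM]
    exact elem_congr fun i hi => by simp [hi]
  | succ n ih =>
    -- The exchange sends site `n` to `n + 2 ^ k`, so the new factor is appended at the right end of
    -- the ordered product and no sign arises.
    rw [elem, map_mul, ← mul_assoc, ih (by omega), ← add_assoc, elem, permAlg_emb,
      blockSwap_apply_of_lt (by omega)]
    simp [add_comm]

/-- The remote copies of a local element are not affected by the earlier block exchanges. -/
lemma exists_permAlg_blockSwap_eq (x : Alg g) : ∃ K, ∀ l k, K ≤ l → l < k →
    permAlg g (blockSwap l : Equiv.Perm ℕ) (permAlg g (blockSwap k : Equiv.Perm ℕ) x)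
      = permAlg g (blockSwap k : Equiv.Perm ℕ) x := by
  induction x using gen_induction with
  | hadd x y hx hy =>
    obtain ⟨K, hK⟩ := hx
    obtain ⟨K', hK'⟩ := hy
    refine ⟨max K K', fun l k hl hk => ?_⟩
    rw [map_add, map_add, hK l k (by omega) hk, hK' l k (by omega) hk]
  | hmul x y hx hy =>
    obtain ⟨K, hK⟩ := hx
    obtain ⟨K', hK'⟩ := hy
    refine ⟨max K K', fun l k hl hk => ?_⟩
    rw [map_mul, map_mul, hK l k (by omega) hk, hK' l k (by omega) hk]
  | hsmul c x hx =>
    obtain ⟨K, hK⟩ := hx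
    refine ⟨K, fun l k hl hk => ?_⟩
    rw [map_smul, map_smul, hK l k hl hk]
  | hemb j a =>
    -- Since `j ≤ l < k < 2 ^ k`, the exchange `k` sends `j` to a site at or beyond `2 ^ k ≥ 2 ^ (l
    -- + 1)`, where the exchange `l` is the identity.
    refine ⟨j, fun l k hl hk => ?_⟩
    have h1 : j < 2 ^ k := (hl.trans hk.le).trans_lt Nat.lt_two_pow_self
    have h2 : 2 ^ (l + 1) ≤ 2 ^ k := Nat.pow_le_pow_right two_pos hk
    rw [permAlg_emb, permAlg_emb, blockSwap_apply_of_lt h1, blockSwap_apply_of_le (by omega)]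

variable {ω : MinFermi g →ₗ[ℂ] ℂ}

/-! ### Product states -/

/-- Product states of a constant sequence factorize over disjoint blocks. -/
lemma IsInfiniteProduct.eventually_eq {ρ : A →ₗ[ℂ] ℂ} (hω : ω ∈ symmetricStates g)
    (h : IsInfiniteProduct ω fun _ => ρ) (a b : Alg g) :
    ∀ᶠ n in atTop, ω (permAction g (blockSwap n) (toMinHom g a) * toMinHom g b)
      = ω (toMinHom g a) * ω (toMinHom g b) := by
  -- Normalization of `ρ` is read off from the product formula for the one-factor tensor `1`.
  have h1 : ρ 1 = 1 := by
    have h := h 1 1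
    rw [elem, elem, Pi.one_apply, map_one, one_mul, toMin_one, hω.1.map_one] at h
    simpa using h.symm
  induction a using elem_induction with
  | hadd x y hx hy =>
    filter_upwards [hx, hy] with n h h'
    rw [map_add, map_add, map_add, add_mul, map_add, h, h', add_mul]
  | hsmul c x hx =>
    filter_upwards [hx] with n h
    rw [map_smul, map_smul, map_smul, smul_mul_assoc, map_smul, h, smul_mul_assoc]
  | helem u N =>
    induction b using elem_induction with
    | hadd x y hx hy =>
      filter_upwards [hx, hy] with n h h'
      rw [map_add, map_add, mul_add, map_add, h, h', mul_add]
    | hsmul c x hx =>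
      filter_upwards [hx] with n h
      rw [map_smul, map_smul, mul_smul_comm, map_smul, h, mul_smul_comm]
    | helem v M =>
      filter_upwards [eventually_ge_atTop (max N M)] with k hk
      have h2 : k < 2 ^ k := Nat.lt_two_pow_self
      -- The exchange is moved onto the right factor. After `u` is cut off at `N`, the two tensors
      -- combine into a single elementary tensor, with `u` in the first block and `v` in the second.
      rw [← hω.2 (blockSwap k), map_mul, permAction_blockSwap_blockSwap, permAction_toMinHom,
        ← map_mul, elem_congr (b := fun i => if i < N then u i else 1) fun i hi => by simp [hi],
        elem_mul_permAlg_elem _ v N k (fun i hi => by simp [not_lt.2 hi]) (by omega) (by omega)]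
      refine (h _ _).trans ?_
      refine Eq.trans ?_ (congrArg₂ _ (h _ _) (h _ _)).symm
      rw [Finset.prod_range_add]
      congr 1
      -- The sites between `N` and `2 ^ k` hold units and contribute `ρ 1 = 1`.
      · obtain ⟨r, hr⟩ := Nat.exists_eq_add_of_le (show N ≤ 2 ^ k by omega)
        rw [hr, Finset.prod_range_add, Finset.prod_eq_one (s := Finset.range r) fun i hi => ?_,
          mul_one]
        · refine Finset.prod_congr rfl fun i hi => ?_
          have := Finset.mem_range.1 hi
          rw [if_pos (by omega)]
        · have := Finset.mem_range.1 hi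
          rw [if_pos (by omega), if_neg (by omega)]
          exact h1
      · refine Finset.prod_congr rfl fun i _ => ?_
        simp

/-- On local elements the sequence is eventually constant. The bound `‖x‖ * ‖y‖`, uniform in `n`,
makes the set of arguments with the right limit closed, so density extends the limit first in one
variable and then in the other. -/
lemma IsInfiniteProduct.isStronglyClustering {ρ : A →ₗ[ℂ] ℂ} (hω : ω ∈ symmetricStates g)
    (h : IsInfiniteProduct ω fun _ => ρ) : IsStronglyClustering ω := by
  have hn : ∀ n (x y : MinFermi g), ‖ω (permAction g (blockSwap n) x * y)‖ ≤ ‖x‖ * ‖y‖ :=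
    fun n x y => (hω.1.norm_apply_le _).trans <| (norm_mul_le _ _).trans <|
      mul_le_mul_of_nonneg_right
        (NonUnitalStarAlgHom.norm_apply_le (permAction g (blockSwap n)) x) (norm_nonneg y)
  intro a b
  induction b using toMinHom_induction with
  | hp =>
    refine isClosed_setOf_tendsto_of_lipschitz
      (f := fun n b => ω (permAction g (blockSwap n) a * b)) (C := ‖a‖) (fun n x y => ?_)
      (continuous_const.mul hω.1.continuous)
    rw [← map_sub, ← mul_sub]
    exact hn n a _
  | h b =>
    induction a using toMinHom_induction with
    | hp =>
      refine isClosed_setOf_tendsto_of_lipschitz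
        (f := fun n a => ω (permAction g (blockSwap n) a * toMinHom g b)) (C := ‖toMinHom g b‖)
        (fun n x y => ?_) (hω.1.continuous.mul continuous_const)
      rw [← map_sub, ← sub_mul, ← map_sub, mul_comm]
      exact hn n _ _
    | h a => exact tendsto_const_nhds.congr' ((h.eventually_eq hω a b).mono fun n h => h.symm)

/-! ### Symmetric states are even -/

/-- Moving the last factor of an elementary tensor to a remote position. -/
lemma apply_elem_mul_factorHom (hω : ω ∈ symmetricStates g) (a : ℕ → A) {n k : ℕ} (hk : n ≤ k)
    (x : A) : ω (toMinHom g (elem g a n) * factorHom g k x)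
      = ω (toMinHom g (elem g a n) * factorHom g n x) := by
  -- The transposition of `n` and `k` fixes all sites below `n`, hence fixes `elem g a n`.
  let τ : finPerm := ⟨Equiv.swap n k, by
    refine (Set.toFinite {n, k}).subset fun i hi => ?_
    by_contra h
    simp only [Set.mem_insert_iff, Set.mem_singleton_iff, not_or] at h
    exact hi (Equiv.swap_apply_of_ne_of_ne h.1 h.2)⟩
  rw [← hω.2 τ, map_mul, permAction_toMinHom, permAction_factorHom,
    permAlg_elem_of_forall fun i hi => Equiv.swap_apply_of_ne_of_ne (by omega) (by omega)]
  rw [show (τ : Equiv.Perm ℕ) k = n from Equiv.swap_apply_right n k]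

/-- Each homogeneous component is spanned by its self-adjoint elements. -/
lemma Grading.selfAdjoint_part_induction {p : A → Prop} (hadd : ∀ x y, p x → p y → p (x + y))
    (hsmul : ∀ (c : ℂ) x, p x → p (c • x)) (e : ZMod 2)
    (h : ∀ x ∈ g.part e, IsSelfAdjoint x → p x) (x : A) (hx : x ∈ g.part e) : p x := by
  -- A homogeneous component is a complex subspace stable under `star`, so it contains the real and
  -- imaginary parts of its elements.
  rw [← realPart_add_I_smul_imaginaryPart x]
  refine hadd _ _ (h _ ?_ (realPart x).2) (hsmul _ _ (h _ ?_ (imaginaryPart x).2))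
  · rw [realPart_apply_coe, ← Complex.coe_smul]
    exact Submodule.smul_mem _ _ (add_mem hx (g.star_mem hx))
  · rw [imaginaryPart_apply_coe, ← Complex.coe_smul (2⁻¹ : ℝ)]
    exact Submodule.smul_mem _ _ (Submodule.smul_mem _ _ (sub_mem hx (g.star_mem hx)))

/-- Sums of copies of an odd self-adjoint element in different factors grow slowly, since the
copies anticommute. -/
lemma norm_sum_factorHom_sq_le {x : A} (hx : x ∈ g.part 1) (hsa : IsSelfAdjoint x)
    (S : Finset ℕ) : ‖∑ k ∈ S, factorHom g k x‖ ^ 2 ≤ S.card * ‖x * x‖ := by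
  -- Anticommutation cancels the mixed terms in pairs and leaves only the squares; the C*-identity
  -- then turns this into a bound of the norm.
  have hsq : (∑ k ∈ S, factorHom g k x) * (∑ k ∈ S, factorHom g k x)
      = ∑ k ∈ S, factorHom g k (x * x) := by
    induction S using Finset.induction_on with
    | empty => simp
    | insert j S hj ih =>
      have hanti : factorHom g j x * (∑ k ∈ S, factorHom g k x)
          + (∑ k ∈ S, factorHom g k x) * factorHom g j x = 0 := by
        rw [Finset.mul_sum, Finset.sum_mul, ← Finset.sum_add_distrib]
        refine Finset.sum_eq_zero fun k hk => ?_
        have hjk : j ≠ k := fun h => hj (h ▸ hk)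
        rw [factorHom_apply, factorHom_apply, ← map_mul, emb_mul_emb_comm hx hx hjk, mul_one,
          sgn_one, neg_one_smul, map_neg, map_mul, neg_add_cancel]
      rw [Finset.sum_insert hj, Finset.sum_insert hj, add_mul, mul_add, mul_add, ih, ← map_mul]
      rw [← add_assoc, add_assoc (factorHom g j (x * x)), hanti, add_zero]
  have hs : IsSelfAdjoint (∑ k ∈ S, factorHom g k x) :=
    isSelfAdjoint_sum S fun k _ => hsa.map (factorHom g k)
  rw [sq, ← CStarRing.norm_star_mul_self, hs.star_eq, hsq]
  refine (norm_sum_le _ _).trans ?_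
  rw [← nsmul_eq_mul, ← Finset.sum_const]
  exact Finset.sum_le_sum fun k _ => norm_factorHom_le k _

/-- Symmetric states vanish on elementary tensors whose last factor is odd. -/
lemma apply_elem_mul_odd (hω : ω ∈ symmetricStates g) (a : ℕ → A) (n : ℕ) {x : A}
    (hx : x ∈ g.part 1) : ω (toMinHom g (elem g a n) * factorHom g n x) = 0 := by
  refine Grading.selfAdjoint_part_induction
    (p := fun x => ω (toMinHom g (elem g a n) * factorHom g n x) = 0) ?_ ?_ 1 ?_ x hx
  · intro x y hx hy
    rw [map_add, mul_add, map_add, hx, hy, add_zero]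
  · intro c x hx
    rw [map_smul, mul_smul_comm, map_smul, hx, smul_zero]
  intro x hx hsa
  set z := ω (toMinHom g (elem g a n) * factorHom g n x)
  set e := toMinHom g (elem g a n)
  -- Summing over `N` sites gives `N * z` exactly, while the anticommuting sum has norm at most `√(N
  -- * ‖x * x‖)`. Squaring and dividing by `N` leaves a bound independent of `N`, which forces `z =
  -- 0`.
  have h1 : ∀ N : ℕ, (N : ℝ) * ‖z‖ ^ 2 ≤ ‖e‖ ^ 2 * ‖x * x‖ := by
    intro N
    rcases N.eq_zero_or_pos with rfl | hN
    · simp only [Nat.cast_zero, zero_mul]; positivity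
    have h2 : ω (e * ∑ k ∈ Finset.Ico n (n + N), factorHom g k x) = N • z := by
      rw [Finset.mul_sum, map_sum, Finset.sum_congr rfl fun k hk =>
        apply_elem_mul_factorHom hω a (Finset.mem_Ico.1 hk).1 x]
      simp [z]
    have h3 := (hω.1.norm_apply_le (e * ∑ k ∈ Finset.Ico n (n + N), factorHom g k x)).trans
      (norm_mul_le _ _)
    have h4 := norm_sum_factorHom_sq_le hx hsa (Finset.Ico n (n + N))
    rw [h2, nsmul_eq_mul, norm_mul, Complex.norm_natCast] at h3
    rw [Nat.card_Ico, Nat.add_sub_cancel_left] at h4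
    have h5 := pow_le_pow_left₀ (by positivity) h3 2
    rw [mul_pow, mul_pow] at h5
    have h6 := h5.trans (mul_le_mul_of_nonneg_left h4 (sq_nonneg ‖e‖))
    have hN' : (0 : ℝ) < N := by exact_mod_cast hN
    refine le_of_mul_le_mul_left ?_ hN'
    linarith
  by_contra hz
  have hz' : 0 < ‖z‖ ^ 2 := by positivity
  obtain ⟨N, hN⟩ := exists_nat_gt (‖e‖ ^ 2 * ‖x * x‖ / ‖z‖ ^ 2)
  rw [div_lt_iff₀ hz'] at hN
  exact (h1 N).not_gt hN

/-- The restriction of a functional to the zeroth tensor factor. -/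
def oneSite (ω : MinFermi g →ₗ[ℂ] ℂ) : A →ₗ[ℂ] ℂ := ω ∘ₗ (factorHom g 0).toLinearMap

lemma oneSite_apply (a : A) : oneSite ω a = ω (factorHom g 0 a) := rfl

/-- The case of the empty elementary tensor, which is `1` whatever the family, so `0` serves as the
family. -/
lemma apply_factorHom (hω : ω ∈ symmetricStates g) (k : ℕ) (x : A) :
    ω (factorHom g k x) = oneSite ω x := by
  simpa [elem, oneSite_apply] using apply_elem_mul_factorHom hω 0 k.zero_le x

/-- Evenness amounts to vanishing on the odd part, which is `apply_elem_mul_odd` for the empty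
elementary tensor. -/
lemma isEvenState_oneSite (hω : ω ∈ symmetricStates g) : g.IsEvenState (oneSite ω) := by
  refine ⟨⟨fun x => ?_, ?_⟩, fun a => ?_⟩
  · rw [oneSite_apply, map_mul, map_star]
    exact hω.1.nonneg _
  · rw [oneSite_apply, map_one]
    exact hω.1.map_one
  · have h : oneSite ω (g.proj 1 a) = 0 := by
      simpa [elem, oneSite_apply] using apply_elem_mul_odd hω 0 0 (g.proj_mem 1 a)
    conv_lhs => rw [← g.proj_add_proj a]
    conv_rhs => rw [← g.proj_add_proj a]
    rw [map_add g.θ, g.mem_part.1 (g.proj_mem 0 a), g.mem_part.1 (g.proj_mem 1 a)]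
    simp only [map_add, map_smul, h, sgn_zero, one_smul, smul_zero]

/-- An elementary tensor is the ordered product of its factors, so splitting off the last factor
suffices, by induction on the length. Both implications into condition 3 end here. -/
lemma isInfiniteProduct_oneSite (h0 : ω 1 = 1) (h : ∀ (a : ℕ → A) (n : ℕ) (x : A),
    ω (toMinHom g (elem g a n) * factorHom g n x) = ω (toMinHom g (elem g a n)) * oneSite ω x) :
    IsInfiniteProduct ω fun _ => oneSite ω := by
  intro a n
  change ω (toMinHom g (elem g a n)) = _
  induction n with
  | zero => simpa [elem] using h0
  | succ n ih => rw [elem, map_mul, Finset.prod_range_succ, ← ih]; exact h a n (a n)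

/-- For `k ≥ n` the exchange can be moved onto `ι_n x`, which becomes `ι_{n + 2 ^ k} x`, and a
transposition fixing `e = elem g a n` brings it back to site `n`. The clustering sequence is thus
eventually the constant `ω (e * ι_n x)`. -/
lemma IsStronglyClustering.isInfiniteProduct (hω : ω ∈ symmetricStates g)
    (h : IsStronglyClustering ω) : IsInfiniteProduct ω fun _ => oneSite ω := by
  refine isInfiniteProduct_oneSite hω.1.map_one fun a n x => ?_
  rw [← apply_factorHom hω n x]
  refine tendsto_nhds_unique (tendsto_const_nhds.congr' ?_)
    (h (toMinHom g (elem g a n)) (factorHom g n x))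
  filter_upwards [eventually_ge_atTop n] with k hk
  have h2 : k < 2 ^ k := Nat.lt_two_pow_self
  rw [← hω.2 (blockSwap k) (permAction g _ _ * _), map_mul (permAction g (blockSwap k)),
    permAction_blockSwap_blockSwap, permAction_factorHom, blockSwap_apply_of_lt (by omega),
    apply_elem_mul_factorHom hω a (n.le_add_right (2 ^ k))]

/-! ### Extreme points -/

/-- Product states are extreme among the symmetric states. -/
lemma IsInfiniteProduct.mem_extremePoints {ρ : A →ₗ[ℂ] ℂ} (hω : ω ∈ symmetricStates g)
    (h : IsInfiniteProduct ω fun _ => ρ) : ω ∈ Set.extremePoints ℝ (symmetricStates g) := by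
  refine mem_extremePoints_iff_left.2 ⟨hω, fun ω₁ h₁ ω₂ h₂ ⟨t, s, ht, hs, hts, hsum⟩ => ?_⟩
  -- Dropping the positive summand `s • ω₂` shows that `ω` dominates `t • ω₁`.
  have hle : ∀ x, t * (ω₁ (star x * x)).re ≤ (ω (star x * x)).re := by
    intro x
    have h3 := (Complex.le_def.1 (h₂.1.nonneg x)).1
    rw [← hsum]
    simp only [LinearMap.add_apply, LinearMap.smul_apply, Complex.add_re, Complex.real_smul,
      Complex.re_ofReal_mul, Complex.zero_re] at h3 ⊢
    nlinarith
  ext x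
  induction x using toMinHom_induction with
  | hp => exact isClosed_eq h₁.1.continuous hω.1.continuous
  | h a =>
    -- Beyond `K₁` an earlier exchange leaves the later copies of `a` alone; beyond `K₂` the state
    -- factorizes on `a*` and `a`.
    obtain ⟨K₁, hK₁⟩ := exists_permAlg_blockSwap_eq a
    obtain ⟨K₂, hK₂⟩ := eventually_atTop.1 (h.eventually_eq hω (star a) a)
    set c := ω (toMinHom g a) with hc
    let y : ℕ → MinFermi g := fun k => permAction g (blockSwap k) (toMinHom g a) - c • 1
    -- Centred copies of `a` in different remote positions are orthogonal for the form `ω (x* y)`: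
    -- applying the earlier exchange `l` brings its copy back to `a`, and factorization across `k`
    -- gives the product of the means.
    have hcross : ∀ l k, max K₁ K₂ ≤ l → l < k → ω (star (y k) * y l) = 0 := by
      intro l k hl hlk
      have h5 : ω (star (permAction g (blockSwap k) (toMinHom g a))
          * permAction g (blockSwap l) (toMinHom g a)) = starRingEnd ℂ c * c := by
        rw [← hω.2 (blockSwap l), map_mul, permAction_blockSwap_blockSwap, map_star,
          permAction_toMinHom, permAction_toMinHom, hK₁ l k (by omega) hlk, ← permAction_toMinHom,
          ← map_star, ← map_star, hK₂ k (by omega), map_star, hω.1.map_star]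
      simp only [y, star_sub, sub_mul, mul_sub, map_sub, h5, star_smul, star_one, mul_smul_comm,
        smul_mul_assoc, mul_one, one_mul, map_smul, hω.2, hω.1.map_one, hω.1.map_star, ← hc,
        smul_eq_mul, Complex.star_def]
      ring
    -- The opposite order follows by conjugation.
    have hcross' : ∀ k l, max K₁ K₂ ≤ k → max K₁ K₂ ≤ l → k ≠ l → ω (star (y k) * y l) = 0 := by
      intro k l hk hl hkl
      rcases lt_or_gt_of_ne hkl with h6 | h6
      · have h7 := hω.1.map_star (star (y l) * y k)
        rwa [star_mul, star_star, hcross k l hk h6, map_zero] at h7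
      · exact hcross l k hl h6
    have hdiag : ∀ k, (ω (star (y k) * y k)).re ≤ ‖toMinHom g a - c • 1‖ ^ 2 := by
      intro k
      have h8 : y k = permAction g (blockSwap k) (toMinHom g a - c • 1) := by
        simp only [y, map_sub, map_smul, map_one]
      refine (Complex.re_le_norm _).trans ((hω.1.norm_apply_le _).trans ?_)
      rw [CStarRing.norm_star_mul_self, ← sq, h8]
      exact pow_le_pow_left₀ (norm_nonneg _)
        (NonUnitalStarAlgHom.norm_apply_le (permAction g (blockSwap k)) _) 2
    set z := ω₁ (toMinHom g a) - c with hz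
    -- The sum of `N` centred copies has second moment of order `N` under `ω`, hence also under `ω₁`
    -- up to the factor `1 / t`, while its mean under the symmetric state `ω₁` is `N * z`. The
    -- Schwarz inequality compares the two.
    have hN : ∀ N : ℕ, t * (N * ‖z‖ ^ 2) ≤ ‖toMinHom g a - c • 1‖ ^ 2 := by
      intro N
      rcases N.eq_zero_or_pos with rfl | hN
      · simp only [Nat.cast_zero, zero_mul, mul_zero]; positivity
      let S := Finset.Ico (max K₁ K₂) (max K₁ K₂ + N)
      have hcard : S.card = N := by simp [S]
      have h9 : ω₁ (∑ k ∈ S, y k) = N * z := by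
        rw [map_sum, Finset.sum_congr rfl fun k _ => show ω₁ (y k) = z by
          simp only [y, map_sub, map_smul, h₁.2, h₁.1.map_one, smul_eq_mul, mul_one, hz],
          Finset.sum_const, hcard, nsmul_eq_mul]
      have h10 : (ω (star (∑ k ∈ S, y k) * ∑ k ∈ S, y k)).re
          ≤ N * ‖toMinHom g a - c • 1‖ ^ 2 := by
        rw [star_sum, Finset.sum_mul_sum, map_sum, Complex.re_sum, ← hcard, ← nsmul_eq_mul,
          ← Finset.sum_const]
        refine Finset.sum_le_sum fun k hk => ?_
        -- Only the diagonal terms survive.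
        rw [map_sum, Finset.sum_eq_single k]
        · exact hdiag k
        · exact fun l hl hlk => hcross' k l (Finset.mem_Ico.1 hk).1 (Finset.mem_Ico.1 hl).1 hlk.symm
        · exact fun h => absurd hk h
      have h11 := h₁.1.norm_sq_le (∑ k ∈ S, y k)
      rw [h9, norm_mul, Complex.norm_natCast, mul_pow] at h11
      have h12 := (mul_le_mul_of_nonneg_left h11 ht.le).trans ((hle _).trans h10)
      have hN' : (0 : ℝ) < N := by exact_mod_cast hN
      refine le_of_mul_le_mul_left ?_ hN'
      linarith
    by_contra hne
    have hz' : 0 < t * ‖z‖ ^ 2 := by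
      have : z ≠ 0 := sub_ne_zero.2 hne
      positivity
    -- A number `N` for which the bound `hN` fails if `z ≠ 0`.
    obtain ⟨N, hN'⟩ := exists_nat_gt (‖toMinHom g a - c • 1‖ ^ 2 / (t * ‖z‖ ^ 2))
    rw [div_lt_iff₀ hz'] at hN'
    have := hN N
    linarith

/-! ### Asymptotic functionals along an ultrafilter -/

section AsymptoticState

lemma norm_apply_factorHom_mul_le (hω : IsState ω) (x : A) (b : MinFermi g) (k : ℕ) :
    ‖ω (factorHom g k x * b)‖ ≤ ‖x‖ * ‖b‖ :=
  (hω.norm_apply_le _).trans <| (norm_mul_le _ _).trans <|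
    mul_le_mul_of_nonneg_right (norm_factorHom_le k x) (norm_nonneg b)

/-- The values stay in a compact disc, so they converge along any ultrafilter. Using one ultrafilter
for all `x` and `b`, rather than subsequences, is what makes the limit linear in `b`. -/
lemma exists_tendsto_apply_factorHom_mul (hω : IsState ω) (x : A) (b : MinFermi g) :
    ∃ z, Tendsto (fun k => ω (factorHom g k x * b)) (hyperfilter ℕ) (𝓝 z) := by
  obtain ⟨z, -, hz⟩ := (isCompact_closedBall (0 : ℂ) (‖x‖ * ‖b‖)).ultrafilter_le_nhds
    ((hyperfilter ℕ).map fun k => ω (factorHom g k x * b)) (by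
      rw [le_principal_iff, Ultrafilter.coe_map, mem_map]
      refine Filter.univ_mem' fun k => ?_
      simpa using norm_apply_factorHom_mul_le hω x b k)
  exact ⟨z, hz⟩

/-- The functional `b ↦ lim_k ω (ι_k x * b)`, the limit being taken along an ultrafilter. -/
def asymptotic (hω : IsState ω) (x : A) : MinFermi g →ₗ[ℂ] ℂ where
  toFun b := (exists_tendsto_apply_factorHom_mul hω x b).choose
  map_add' b c := by
    refine tendsto_nhds_unique (exists_tendsto_apply_factorHom_mul hω x (b + c)).choose_spec ?_
    simp only [mul_add, map_add]
    exact (exists_tendsto_apply_factorHom_mul hω x b).choose_spec.add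
      (exists_tendsto_apply_factorHom_mul hω x c).choose_spec
  map_smul' r b := by
    refine tendsto_nhds_unique (exists_tendsto_apply_factorHom_mul hω x (r • b)).choose_spec ?_
    simp only [mul_smul_comm, map_smul]
    exact (exists_tendsto_apply_factorHom_mul hω x b).choose_spec.const_smul r

lemma tendsto_asymptotic (hω : IsState ω) (x : A) (b : MinFermi g) :
    Tendsto (fun k => ω (factorHom g k x * b)) (hyperfilter ℕ) (𝓝 (asymptotic hω x b)) :=
  (exists_tendsto_apply_factorHom_mul hω x b).choose_spec

/-- The hyperfilter refines `atTop`, so an eventually constant sequence has its constant as limit.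
-/
lemma asymptotic_eq_of_eventually (hω : IsState ω) {x : A} {b : MinFermi g} {z : ℂ}
    (h : ∀ᶠ k in atTop, ω (factorHom g k x * b) = z) : asymptotic hω x b = z :=
  tendsto_nhds_unique (tendsto_asymptotic hω x b) <|
    tendsto_const_nhds.congr' <| Nat.hyperfilter_le_atTop (h.mono fun _ h => h.symm)

lemma continuous_asymptotic (hω : IsState ω) (x : A) : Continuous (asymptotic hω x) :=
  AddMonoidHomClass.continuous_of_bound _ ‖x‖ fun b =>
    le_of_tendsto (tendsto_asymptotic hω x b).norm <|
      Eventually.of_forall fun k => norm_apply_factorHom_mul_le hω x b k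

/-- A partition of unity in one remote factor decomposes `ω`; this yields the convex combination to
which extremality is applied. -/
lemma asymptotic_add_asymptotic (hω : IsState ω) {x y : A} (h : x + y = 1) (b : MinFermi g) :
    asymptotic hω x b + asymptotic hω y b = ω b := by
  refine tendsto_nhds_unique ((tendsto_asymptotic hω x b).add (tendsto_asymptotic hω y b)) ?_
  simp only [← map_add, ← add_mul, h, map_one, one_mul]
  exact tendsto_const_nhds

lemma asymptotic_one (hω : ω ∈ symmetricStates g) (x : A) : asymptotic hω.1 x 1 = oneSite ω x :=
  asymptotic_eq_of_eventually _ <| Eventually.of_forall fun k => by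
    rw [mul_one, apply_factorHom hω]

/-- A finite permutation fixes all remote sites, so it does not move `ι_k x` for large `k`, and
invariance of `ω` passes to the limit. -/
lemma asymptotic_permAction (hω : ω ∈ symmetricStates g) (x : A) (σ : finPerm) (b : MinFermi g) :
    asymptotic hω.1 x (permAction g σ b) = asymptotic hω.1 x b := by
  refine tendsto_nhds_unique (tendsto_asymptotic hω.1 x _)
    ((tendsto_asymptotic hω.1 x b).congr' (Nat.hyperfilter_le_atTop ?_))
  have h : ∀ᶠ k in atTop, (σ : Equiv.Perm ℕ) k = k := by
    rw [← Nat.cofinite_eq_atTop]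
    exact σ.2
  filter_upwards [h] with k hk
  rw [← hω.2 σ, map_mul, permAction_factorHom, hk]

/-- For local `b` the even element `ι_k (y* y)` eventually commutes with `b*`, so that `ι_k (y* y)
b* b = (ι_k y b)* (ι_k y b)`. Only `y* y` has to be even, not `y`. Continuity extends positivity to
all `b`. -/
lemma asymptotic_star_mul_self_nonneg (hω : IsState ω) {y : A} (hy : star y * y ∈ g.part 0)
    (b : MinFermi g) : 0 ≤ asymptotic hω (star y * y) (star b * b) := by
  induction b using toMinHom_induction with
  | hp =>
    exact isClosed_le continuous_const
      ((continuous_asymptotic hω _).comp (continuous_star.mul continuous_id))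
  | h b =>
    refine ge_of_tendsto (tendsto_asymptotic hω _ _) (Nat.hyperfilter_le_atTop ?_)
    filter_upwards [eventually_commute_emb hy (star b)] with k hk
    have h : factorHom g k (star y * y) * (star (toMinHom g b) * toMinHom g b)
        = star (factorHom g k y * toMinHom g b) * (factorHom g k y * toMinHom g b) := by
      rw [← mul_assoc, ← map_star (toMinHom g), factorHom_apply, ← map_mul, hk.eq, map_mul,
        ← factorHom_apply, map_mul, star_mul, map_star, map_star]
      simp only [mul_assoc]
    rw [h]
    exact hω.nonneg _

end AsymptoticState

/-! ### Factorization of extreme symmetric states -/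

/-- The normalized asymptotic functional of a positive even element is a symmetric state. -/
lemma inv_smul_asymptotic_mem (hω : ω ∈ symmetricStates g) {x y : A} (hx : x ∈ g.part 0)
    (hy : x = star y * y) {r : ℝ} (hr : 0 < r) (hxr : oneSite ω x = r) :
    r⁻¹ • asymptotic hω.1 x ∈ symmetricStates g := by
  refine ⟨⟨fun b => ?_, ?_⟩, fun σ b => ?_⟩
  · subst hy
    have h := asymptotic_star_mul_self_nonneg hω.1 hx b
    rw [LinearMap.smul_apply]
    exact smul_nonneg (inv_nonneg.2 hr.le) h
  · rw [LinearMap.smul_apply, asymptotic_one hω, hxr, Complex.real_smul, ← Complex.ofReal_mul,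
      inv_mul_cancel₀ hr.ne', Complex.ofReal_one]
  · rw [LinearMap.smul_apply, LinearMap.smul_apply, asymptotic_permAction hω]

/-- The asymptotic functionals of an extreme symmetric state are multiples of the state. -/
lemma asymptotic_eq_of_mem_extremePoints (hω : ω ∈ Set.extremePoints ℝ (symmetricStates g))
    {h : A} (heven : h ∈ g.part 0) (hsa : IsSelfAdjoint h) (hn : ‖h‖ ≤ 1 / 2) (b : MinFermi g) :
    asymptotic hω.1.1 ((2⁻¹ : ℂ) • (1 + h)) b = oneSite ω ((2⁻¹ : ℂ) • (1 + h)) * ω b := by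
  have hs := hω.1
  have hρ := (isEvenState_oneSite hs).1
  have hmem : ∀ h : A, h ∈ g.part 0 → (2⁻¹ : ℂ) • (1 + h) ∈ g.part 0 := fun h hh =>
    Submodule.smul_mem _ _ (add_mem g.one_mem hh)
  -- Both `(1 + h) / 2` and `(1 - h) / 2` are positive, and they add up to `1`.
  obtain ⟨y, hy⟩ := exists_star_mul_self_eq hsa (hn.trans (by norm_num))
  obtain ⟨y', hy'⟩ := exists_star_mul_self_eq hsa.neg
    (by rw [norm_neg]; exact hn.trans (by norm_num))
  have hreal : oneSite ω h = ((oneSite ω h).re : ℂ) := by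
    have h1 := hρ.map_star h
    rw [hsa.star_eq] at h1
    exact (Complex.conj_eq_iff_re.1 h1.symm).symm
  set c := (oneSite ω h).re
  -- The bound `‖h‖ ≤ 1 / 2`, stricter than positivity needs, keeps both weights `(1 ± c) / 2`
  -- strictly positive, so that normalization is possible.
  have hc : |c| ≤ 1 / 2 := (Complex.abs_re_le_norm _).trans ((hρ.norm_apply_le h).trans hn)
  obtain ⟨hc1, hc2⟩ := abs_le.1 hc
  have hx : oneSite ω ((2⁻¹ : ℂ) • (1 + h)) = ((1 + c) / 2 : ℝ) := by
    rw [map_smul, map_add, hρ.map_one, hreal, smul_eq_mul]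
    push_cast
    ring
  have hx' : oneSite ω ((2⁻¹ : ℂ) • (1 + -h)) = ((1 - c) / 2 : ℝ) := by
    rw [map_smul, map_add, map_neg, hρ.map_one, hreal, smul_eq_mul]
    push_cast
    ring
  have hr : 0 < (1 + c) / 2 := by linarith
  have hr' : 0 < (1 - c) / 2 := by linarith
  have h1 := inv_smul_asymptotic_mem hs (hmem h heven) hy hr hx
  have h2 := inv_smul_asymptotic_mem hs (hmem (-h) (neg_mem heven)) hy' hr' hx'
  -- The state `ω` is the convex combination of the two normalized asymptotic states with these
  -- weights, so the first of them equals `ω`.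
  have h3 := (mem_extremePoints_iff_left.1 hω).2 _ h1 _ h2
    ⟨(1 + c) / 2, (1 - c) / 2, hr, hr', by ring, by
      rw [smul_inv_smul₀ hr.ne', smul_inv_smul₀ hr'.ne']
      ext b
      exact asymptotic_add_asymptotic hs.1 (by module) b⟩
  rw [hx, ← Complex.real_smul]
  conv_rhs => rw [← h3]
  rw [LinearMap.smul_apply, smul_inv_smul₀ hr.ne']

/-- Extreme symmetric states are product states. -/
lemma isInfiniteProduct_of_mem_extremePoints
    (hω : ω ∈ Set.extremePoints ℝ (symmetricStates g)) :
    IsInfiniteProduct ω fun _ => oneSite ω := by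
  have hs := hω.1
  have hρ := isEvenState_oneSite hs
  refine isInfiniteProduct_oneSite hs.1.map_one fun a n x => ?_
  set e := toMinHom g (elem g a n) with he
  -- For large `k` the even factor `ι_k x` commutes past `e`, after which symmetry moves it to site
  -- `n`; the sequence defining the limit is eventually constant.
  have heven : ∀ x ∈ g.part 0, asymptotic hs.1 x e = ω (e * factorHom g n x) := by
    intro x hx
    refine asymptotic_eq_of_eventually _ ?_
    filter_upwards [eventually_commute_emb hx (elem g a n), eventually_ge_atTop n] with k hk hnk
    rw [← apply_elem_mul_factorHom hs a hnk, he, factorHom_apply, ← map_mul, hk.eq, map_mul]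
  have hodd : ω (e * factorHom g n (g.proj 1 x)) = 0 := apply_elem_mul_odd hs a n (g.proj_mem 1 x)
  have key : ∀ x ∈ g.part 0, ω (e * factorHom g n x) = ω e * oneSite ω x := by
    refine Grading.selfAdjoint_part_induction
      (p := fun x => ω (e * factorHom g n x) = ω e * oneSite ω x) ?_ ?_ 0 ?_
    · intro x y hx hy
      rw [map_add, mul_add, map_add, map_add, hx, hy, mul_add]
    · intro c x hx
      rw [map_smul, mul_smul_comm, map_smul, map_smul, hx, mul_smul_comm]
    intro x hx hsa
    -- Scaling brings `x` into the ball of radius `1 / 2`; the summand `1` keeps the denominator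
    -- positive when `x = 0`.
    set r : ℝ := (2 * (‖x‖ + 1))⁻¹ with hr
    have hr0 : 0 < r := by positivity
    have hn : ‖r • x‖ ≤ 1 / 2 := by
      rw [norm_smul, Real.norm_of_nonneg hr0.le, hr, inv_mul_le_iff₀ (by positivity)]
      linarith
    have hrx : r • x ∈ g.part 0 := by
      rw [← Complex.coe_smul]
      exact Submodule.smul_mem _ _ hx
    have h1 := asymptotic_eq_of_mem_extremePoints hω hrx (IsSelfAdjoint.smul (.all r) hsa) hn e
    rw [heven _ (Submodule.smul_mem _ _ (add_mem g.one_mem hrx)), ← Complex.coe_smul] at h1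
    simp only [map_smul, map_add, map_one, mul_add, mul_smul_comm, mul_one, smul_eq_mul,
      hρ.1.map_one] at h1
    have h2 : (r : ℂ) ≠ 0 := by exact_mod_cast hr0.ne'
    -- In the identity for `(1 + r • x) / 2` the contributions of the unit agree on both sides; what
    -- remains is `r / 2` times the claim.
    refine mul_left_cancel₀ h2 ?_
    linear_combination 2 * h1
  -- The odd part of `x` contributes zero on both sides, so only the even part matters.
  conv_lhs => rw [← g.proj_add_proj x]
  conv_rhs => rw [← g.proj_add_proj x]
  rw [map_add, mul_add, map_add, map_add, hodd, key _ (g.proj_mem 0 x),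
    hρ.apply_odd (g.proj_mem 1 x), add_zero, add_zero]

end Fermi
end

/-! ### The equivalence of the three conditions -/

theorem mainTheorem4 {A : Type*} [CStarAlgebra A] (g : Fermi.Grading A)
    (ω : Fermi.MinFermi g →ₗ[ℂ] ℂ) (hω : ω ∈ Fermi.symmetricStates g) :
    List.TFAE [
      ω ∈ Set.extremePoints ℝ (Fermi.symmetricStates g),
      Fermi.IsStronglyClustering ω,
      ∃ ρ : A →ₗ[ℂ] ℂ, g.IsEvenState ρ ∧ Fermi.IsInfiniteProduct ω (fun _ => ρ)] := by
  -- The witness here and in the next implication is `oneSite ω`, the restriction of `ω` to one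
  -- tensor factor.
  tfae_have 1 → 3 := fun h =>
    ⟨_, Fermi.isEvenState_oneSite hω, Fermi.isInfiniteProduct_of_mem_extremePoints h⟩
  tfae_have 2 → 3 := fun h =>
    ⟨_, Fermi.isEvenState_oneSite hω, h.isInfiniteProduct hω⟩
  tfae_have 3 → 1 := fun ⟨_, _, h⟩ => h.mem_extremePoints hω
  tfae_have 3 → 2 := fun ⟨_, _, h⟩ => h.isStronglyClustering hω
  tfae_finish
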